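/- **Theorem D (Dichotomy Theorem).** Let $r\ge 1$ be an integer and $K,\lambda>0$. Call $S:\mathbb R^{r+1}\to\mathbb R$ a *Newtonian local energy of range $r$ with strong twist* (with constants $K,\lambda$) if $S(\xi_1,\dots,\xi_{r+1})=\sum_{j=1}^r f_j(\xi_1,\xi_{j+1})$ with $f_j\in C^2(\mathbb R^2)$ such that for all $1\le j\le r$ and all $\nu,\mu\in\mathbb R$: 1. $f_j(\nu+1,\mu+1)=f_j(\nu,\mu)$; 2. $|\partial_i\partial_k f_j(\nu,\mu)|\le K/r$ for $i,k\in\{1,2\}$; 3. $f_j(\nu,\mu)\to\infty$ as $|\nu-\mu|\to\infty$; 4. $\partial_1\partial_2 f_j(\nu,\mu)\le-\lambda$. A sequence $x\in\mathbb R^{\mathbb Z}$ is a *global minimizer* of $S$ if for all integers $i_0\le i_1$ and all $v\in\mathbb R^{\mathbb Z}$ supported in $[i_0,i_1]$, $$\sum_{i=i_0-r}^{i_1}S(x_i,\dots,x_{i+r})\le\sum_{i=i_0-r}^{i_1}S(x_i+v_i,\dots,x_{i+r}+v_{i+r}).$$ For $k,l\in\mathbb Z$ put $(\tau_{k,l}x)_i:=x_{i-k}+l$;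 $x$ is *Birkhoff* if for all $k,l\in\mathbb Z$ either $\tau_{k,l}x\le x$ or $\tau_{k,l}x\ge x$ pointwise. There is a constant $d\in\mathbb N$, depending only on $r$, $K$ and $\lambda$, such that for every such $S$ and every global minimizer $x$ of $S$ one of the following two cases holds. * $x$ is Birkhoff. * $x$ is not Birkhoff, and there are sequences of integers $(k_n)_{n\ge0}$ and $(l_n)_{n\ge0}$, both strictly increasing or both strictly decreasing, with $|k_{n+1}-k_n|\le d$ and $|l_n-k_n|\le r$ for all $n$, such that $$(x_{k_n+1}-x_{k_n}+1)(x_{l_n}-x_{l_n+1}+1)\ge 2^n\ \text{ for all } n,$$ or $$(x_{k_n+1}-x_{k_n}-1)(x_{l_n}-x_{l_n+1}-1)\ge 2^n\ \text{ for all } n.$$ Moreover, for every $n$ at least one of $x_{k_n+1}-x_{k_n}\ge 2^{n/2}-1$ and $x_{l_n}-x_{l_n+1}\ge 2^{n/2}-1$ holds. -/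

import Mathlib

namespace NewtonianCrystal

/-- The partial derivative `∂₁ f` of a function of two real variables. -/
noncomputable def pd1 (f : ℝ → ℝ → ℝ) : ℝ → ℝ → ℝ :=
  fun ν μ => deriv (fun t => f t μ) ν

/-- The partial derivative `∂₂ f` of a function of two real variables. -/
noncomputable def pd2 (f : ℝ → ℝ → ℝ) : ℝ → ℝ → ℝ :=
  fun ν μ => deriv (fun t => f ν t) μ

/-- The conditions on one pair interaction `f` of a Newtonian local energy: it is `C²`, periodic,
has second derivatives bounded by `C`, is coercive, and has the strong twist property with
constant `lam`. -/
structure IsPairInteraction (C lam : ℝ) (f : ℝ → ℝ → ℝ) : Prop where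
  contDiff : ContDiff ℝ 2 (fun p : ℝ × ℝ => f p.1 p.2)
  periodic : ∀ ν μ : ℝ, f (ν + 1) (μ + 1) = f ν μ
  bound11 : ∀ ν μ : ℝ, |pd1 (pd1 f) ν μ| ≤ C
  bound12 : ∀ ν μ : ℝ, |pd1 (pd2 f) ν μ| ≤ C
  bound21 : ∀ ν μ : ℝ, |pd2 (pd1 f) ν μ| ≤ C
  bound22 : ∀ ν μ : ℝ, |pd2 (pd2 f) ν μ| ≤ C
  coercive : ∀ M : ℝ, ∃ R : ℝ, ∀ ν μ : ℝ, R ≤ |ν - μ| → M ≤ f ν μ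
  twist : ∀ ν μ : ℝ, pd1 (pd2 f) ν μ ≤ -lam

/-- `S : ℝ^(r+1) → ℝ` is a Newtonian local energy of range `r` with strong twist, with uniform
constants `K` (bound on the second derivatives) and `lam` (twist): it is the sum of pair
interactions between the first particle and each of the `r` following ones. -/
def IsLocalEnergy (r : ℕ) (K lam : ℝ) (S : (Fin (r + 1) → ℝ) → ℝ) : Prop :=
  ∃ f : Fin r → ℝ → ℝ → ℝ,
    (∀ ξ : Fin (r + 1) → ℝ, S ξ = ∑ j : Fin r, f j (ξ 0) (ξ j.succ)) ∧
    ∀ j : Fin r, IsPairInteraction (K / r) lam (f j)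

/-- `S_i(x) = S(x_i, …, x_{i+r})`. -/
def localEnergyAt {r : ℕ} (S : (Fin (r + 1) → ℝ) → ℝ) (i : ℤ) (x : ℤ → ℝ) : ℝ :=
  S (fun m : Fin (r + 1) => x (i + (m : ℕ)))

/-- `W_B(x) = ∑_{i ∈ B} S_i(x)`, for the segment `B = [i₀ - r, i₁]`. -/
noncomputable def segmentEnergy {r : ℕ} (S : (Fin (r + 1) → ℝ) → ℝ) (i₀ i₁ : ℤ) (x : ℤ → ℝ) : ℝ :=
  ∑ i ∈ Finset.Icc (i₀ - r) i₁, localEnergyAt S i x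

/-- Global minimizers: no variation supported in a finite segment `[i₀, i₁]`, the interior of
`B = [i₀ - r, i₁]`, lowers the energy `W_B`. -/
def IsGlobalMinimizer {r : ℕ} (S : (Fin (r + 1) → ℝ) → ℝ) (x : ℤ → ℝ) : Prop :=
  ∀ i₀ i₁ : ℤ, i₀ ≤ i₁ → ∀ v : ℤ → ℝ, Function.support v ⊆ Set.Icc i₀ i₁ →
    segmentEnergy S i₀ i₁ x ≤ segmentEnergy S i₀ i₁ (x + v)

/-- The translation operator `(τ_{k,l} x)_i = x_{i-k} + l`. -/
def shiftSeq (k l : ℤ) (x : ℤ → ℝ) : ℤ → ℝ := fun i => x (i - k) + l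

/-- Birkhoff sequences: ordered (pointwise) with respect to all their translates. -/
def IsBirkhoff (x : ℤ → ℝ) : Prop :=
  ∀ k l : ℤ, shiftSeq k l x ≤ x ∨ x ≤ shiftSeq k l x

end NewtonianCrystal

namespace NewtonianCrystal

open Finset

/-! Two global minimizers `x`, `y` are compared through their pointwise maximum and minimum. By the
twist condition, replacing the pair by (max, min) on a segment lowers the total energy where `x - y`
changes sign, up to a cost at the two ends of the segment. At a crossing the gain is at least a
constant times `V ^ 2`, with `V` the local size of `x - y`: either both adjacent differences are
comparable to `V` and the strong twist pays at once, or one of them is small, so that max and min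
nearly touch there, and energy is gained by pulling them apart at that single site. As neither `x`
nor `y` can be improved, the sum of `V ^ 2` over sparse crossings is bounded by the squared negative
parts of `x - y` near the two ends (`exists_crossing_bound`); exchanging `x` and `y` gives the same
for positive parts.

This yields a comparison principle (`IsPairMinimizer.le_of_le_ends`) and a dichotomy for unordered
pairs (`exists_growth_or_crossesUp`). Place windows at equal distances to both sides of a crossing.
If, on one side, the size at the crossing in each late window dominates a fixed fraction of the sum
of the earlier ones, the sizes grow exponentially. If this fails infinitely often on both sides, the
windows where it fails must have constant sign, opposite on the two sides, and comparison extends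
these signs to half-lines: there is essentially one crossing.

For the theorem, apply the dichotomy to `x` and its translate by one site. Growth is the second case
of the theorem. Otherwise `x` is monotone near both ends, and then every translate is ordered with
respect to `x`. Growth of `τx - x` is impossible, because monotonicity and a Harnack inequality
bound it at the sites in question. A single crossing is impossible because, for a minimizer `z`
invariant under the same translation, `x - z` would tend to the same infinity at both ends, against
comparison with the integer translates. Such a `z` minimizes the energy per period; sorting
translates shows that longer periods cannot do better, whence `z` is a global minimizer. All
constants come from `r`, `K / r` and `lam`, so `d` is uniform. -/

/-! ### Finite-difference bounds for pair interactions. -/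

/-- The finite-difference form of the bounds on the second derivatives of a pair interaction. -/
structure HasPairBounds (C lam : ℝ) (f : ℝ → ℝ → ℝ) : Prop where
  lower : ∀ a a' b b' : ℝ, a ≤ a' → b ≤ b' →
    lam * ((a' - a) * (b' - b)) ≤ f a b' + f a' b - f a b - f a' b'
  upper : ∀ a a' b b' : ℝ, a ≤ a' → b ≤ b' →
    f a b' + f a' b - f a b - f a' b' ≤ C * ((a' - a) * (b' - b))
  second_left : ∀ a a' b s : ℝ, 0 ≤ s →
    f (a + s) b - f a b - (f a' b - f (a' - s) b) ≤ C * s * (|a - a'| + 2 * s)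
  second_right : ∀ a a' b s : ℝ, 0 ≤ s →
    f b (a + s) - f b a - (f b a' - f b (a' - s)) ≤ C * s * (|a - a'| + 2 * s)

/-- A function whose second derivative is bounded by `C` has bounded second differences. -/
theorem second_difference_le {g : ℝ → ℝ} {C : ℝ} (hg : Differentiable ℝ g)
    (hg' : Differentiable ℝ (deriv g)) (hC : ∀ t, |deriv (deriv g) t| ≤ C) (a a' s : ℝ)
    (hs : 0 ≤ s) : g (a + s) - g a - (g a' - g (a' - s)) ≤ C * s * (|a - a'| + 2 * s) := by
  have lip : ∀ p q, deriv g p - deriv g q ≤ C * |p - q| := fun p q => by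
    have := Convex.norm_image_sub_le_of_norm_deriv_le (f := deriv g) (s := Set.univ) (C := C)
      (x := q) (y := p)
      (fun x _ => hg' x) (fun x _ => by simpa using hC x) convex_univ trivial trivial
    simp only [Real.norm_eq_abs] at this
    exact (le_abs_self _).trans this
  have hC0 : 0 ≤ C := (abs_nonneg _).trans (hC 0)
  have hd : ∀ t, HasDerivAt (fun t => g (a + t) + g (a' - t))
      (deriv g (a + t) - deriv g (a' - t)) t := fun t => by
    have h1 := (hg (a + t)).hasDerivAt.comp t ((hasDerivAt_id t).const_add a)
    have h2 := (hg (a' - t)).hasDerivAt.comp t ((hasDerivAt_id t).const_sub a')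
    refine HasDerivAt.congr_deriv (h1.add h2) ?_
    ring
  have := Convex.image_sub_le_mul_sub_of_deriv_le (D := Set.Icc 0 s) (convex_Icc 0 s)
    (f := fun t => g (a + t) + g (a' - t)) (C := C * (|a - a'| + 2 * s))
    (fun t _ => (hd t).continuousAt.continuousWithinAt)
    (fun t _ => (hd t).differentiableAt.differentiableWithinAt)
    (fun t ht => by
      rw [interior_Icc] at ht
      rw [(hd t).deriv]
      refine (lip _ _).trans (mul_le_mul_of_nonneg_left ?_ hC0)
      have h3 : a + t - (a' - t) = (a - a') + 2 * t := by ring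
      rw [h3]
      refine (abs_add_le _ _).trans ?_
      rw [abs_of_nonneg (by linarith [ht.1] : 0 ≤ 2 * t)]
      linarith [ht.2]) 0 ⟨le_rfl, hs⟩ s ⟨hs, le_rfl⟩ hs
  simp only [add_zero, sub_zero] at this
  linarith

/-- The mixed difference is the integral of `∂₁∂₂ f` over a rectangle; here the mean value
inequality is used twice, once in each variable, instead of integrating. -/
theorem IsPairInteraction.hasPairBounds {C lam : ℝ} {f : ℝ → ℝ → ℝ}
    (hf : IsPairInteraction C lam f) : HasPairBounds C lam f := by
  set F : ℝ × ℝ → ℝ := fun p => f p.1 p.2 with hF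
  have hF2 : ContDiff ℝ 2 F := hf.contDiff
  have hFd : Differentiable ℝ F := hF2.differentiable (by norm_num)
  have hF1 : ContDiff ℝ 1 (fderiv ℝ F) := hF2.fderiv_right (by norm_num)
  have hF1d : Differentiable ℝ (fderiv ℝ F) := hF1.differentiable (by norm_num)
  have hl : ∀ μ t : ℝ, HasDerivAt (fun t : ℝ => (t, μ)) ((1 : ℝ), (0 : ℝ)) t := fun μ t =>
    (hasDerivAt_id t).prodMk (hasDerivAt_const t μ)
  have hr : ∀ ν t : ℝ, HasDerivAt (fun t : ℝ => (ν, t)) ((0 : ℝ), (1 : ℝ)) t := fun ν t =>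
    (hasDerivAt_const t ν).prodMk (hasDerivAt_id t)
  have d1 : ∀ μ t : ℝ, HasDerivAt (fun t => f t μ) (fderiv ℝ F (t, μ) (1, 0)) t := fun μ t =>
    HasFDerivAt.comp_hasDerivAt (l := F) (f := fun t => (t, μ)) t (hFd (t, μ)).hasFDerivAt (hl μ t)
  have d2 : ∀ ν t : ℝ, HasDerivAt (fun t => f ν t) (fderiv ℝ F (ν, t) (0, 1)) t := fun ν t =>
    HasFDerivAt.comp_hasDerivAt (l := F) (f := fun t => (ν, t)) t (hFd (ν, t)).hasFDerivAt (hr ν t)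
  have e1 : pd1 f = fun ν μ => fderiv ℝ F (ν, μ) (1, 0) := by
    funext ν μ; exact (d1 μ ν).deriv
  have e2 : pd2 f = fun ν μ => fderiv ℝ F (ν, μ) (0, 1) := by
    funext ν μ; exact (d2 ν μ).deriv
  have dd : ∀ v : ℝ × ℝ, Differentiable ℝ (fun p => fderiv ℝ F p v) := fun v p =>
    (hF1d p).clm_apply (differentiableAt_const v)
  have dd21 : ∀ μ, Differentiable ℝ (fun t => pd2 f t μ) := fun μ t => by
    rw [e2]
    exact ((dd (0, 1)) (t, μ)).comp t (hl μ t).differentiableAt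
  have dd11 : ∀ μ, Differentiable ℝ (fun t => pd1 f t μ) := fun μ t => by
    rw [e1]
    exact ((dd (1, 0)) (t, μ)).comp t (hl μ t).differentiableAt
  have dd22 : ∀ ν, Differentiable ℝ (fun t => pd2 f ν t) := fun ν t => by
    rw [e2]
    exact ((dd (0, 1)) (ν, t)).comp t (hr ν t).differentiableAt
  have D1 : ∀ μ, Differentiable ℝ (fun t => f t μ) := fun μ t => (d1 μ t).differentiableAt
  have D2 : ∀ ν, Differentiable ℝ (fun t => f ν t) := fun ν t => (d2 ν t).differentiableAt
  have dφ : ∀ a a' μ, deriv (fun μ => f a' μ - f a μ) μ = pd2 f a' μ - pd2 f a μ :=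
    fun a a' μ => by
      rw [deriv_fun_sub (D2 a' μ) (D2 a μ)]
      rfl
  refine ⟨fun a a' b b' ha hb => ?_, fun a a' b b' ha hb => ?_, fun a a' b s hs => ?_,
    fun a a' b s hs => ?_⟩
  · have := image_sub_le_mul_sub_of_deriv_le (f := fun μ => f a' μ - f a μ)
      (C := -lam * (a' - a)) ((D2 a').sub (D2 a)) (fun μ => by
        rw [dφ]
        exact image_sub_le_mul_sub_of_deriv_le (f := fun t => pd2 f t μ) (dd21 μ)
          (fun ν => hf.twist ν μ) ha) hb
    linarith
  · have := mul_sub_le_image_sub_of_le_deriv (f := fun μ => f a' μ - f a μ)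
      (C := -C * (a' - a)) ((D2 a').sub (D2 a)) (fun μ => by
        rw [dφ]
        exact mul_sub_le_image_sub_of_le_deriv (f := fun t => pd2 f t μ) (dd21 μ)
          (fun ν => (abs_le.1 (hf.bound12 ν μ)).1) ha) hb
    linarith
  · exact second_difference_le (g := fun t => f t b) (D1 b) (dd11 b)
      (fun t => hf.bound11 t b) a a' s hs
  · exact second_difference_le (g := fun t => f b t) (D2 b) (dd22 b)
      (fun t => hf.bound22 b t) a a' s hs

/-! ### Energies, excesses and neighbour sums. -/

/-- The energy carried by the site `i` for the pair interactions `f`. -/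
noncomputable def pairEnergy {r : ℕ} (f : Fin r → ℝ → ℝ → ℝ) (i : ℤ) (x : ℤ → ℝ) : ℝ :=
  ∑ j : Fin r, f j (x i) (x (i + ((j : ℕ) + 1)))

/-- The energy of the segment `[a, b]`. -/
noncomputable def energyOn {r : ℕ} (f : Fin r → ℝ → ℝ → ℝ) (a b : ℤ) (x : ℤ → ℝ) : ℝ :=
  ∑ i ∈ Icc a b, pairEnergy f i x

/-- Global minimizers, in terms of the pair interactions. -/
def IsPairMinimizer {r : ℕ} (f : Fin r → ℝ → ℝ → ℝ) (x : ℤ → ℝ) : Prop :=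
  ∀ (i₀ i₁ : ℤ) (y : ℤ → ℝ), i₀ ≤ i₁ → (∀ i, i ∉ Icc i₀ i₁ → y i = x i) →
    energyOn f (i₀ - r) i₁ x ≤ energyOn f (i₀ - r) i₁ y

/-- The excess of `x` over `y`, the positive part of `x - y`. -/
noncomputable def excess (x y : ℤ → ℝ) (t : ℤ) : ℝ := max (x t - y t) 0

/-- The sum over the neighbours of the site `s`. -/
noncomputable def nbrSum (r : ℕ) (h : ℤ → ℝ) (s : ℤ) : ℝ := ∑ t ∈ (Icc (s - r) (s + r)).erase s, h t

/-- The sum over the window of radius `r` around the site `w`. -/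
noncomputable def windowSum (r : ℕ) (h : ℤ → ℝ) (w : ℤ) : ℝ := ∑ t ∈ Icc (w - r) (w + r), h t

theorem excess_nonneg (x y : ℤ → ℝ) (t : ℤ) : 0 ≤ excess x y t := le_max_right _ _

theorem excess_le_abs (x y : ℤ → ℝ) (t : ℤ) : excess x y t ≤ |x t - y t| :=
  max_le (le_abs_self _) (abs_nonneg _)

theorem excess_add_excess (x y : ℤ → ℝ) (t : ℤ) : excess x y t + excess y x t = |x t - y t| := by
  unfold excess
  rcases le_total (x t) (y t) with h | h
  · rw [max_eq_right (by linarith), max_eq_left (by linarith), abs_of_nonpos (by linarith)]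
    ring
  · rw [max_eq_left (by linarith), max_eq_right (by linarith), abs_of_nonneg (by linarith)]
    ring

theorem excess_eq_zero {x y : ℤ → ℝ} {t : ℤ} (h : x t ≤ y t) : excess x y t = 0 :=
  max_eq_right (by linarith)

theorem windowSum_eq (r : ℕ) (h : ℤ → ℝ) (w : ℤ) : windowSum r h w = h w + nbrSum r h w := by
  unfold windowSum nbrSum
  rw [add_sum_erase]
  simp

theorem windowSum_nonneg (r : ℕ) {h : ℤ → ℝ} (hh : ∀ t, 0 ≤ h t) (w : ℤ) : 0 ≤ windowSum r h w :=
  sum_nonneg fun t _ => hh t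

theorem windowSum_eq_zero {r : ℕ} {h : ℤ → ℝ} {w : ℤ} (hh : ∀ t ∈ Icc (w - r) (w + r), h t = 0) :
    windowSum r h w = 0 := sum_eq_zero hh

theorem sum_fin_add (r : ℕ) (h : ℤ → ℝ) (m : ℤ) :
    ∑ j : Fin r, h (m + ((j : ℕ) + 1)) = ∑ t ∈ Icc (m + 1) (m + r), h t := by
  refine sum_bij (fun j _ => m + ((j : ℕ) + 1)) ?_ ?_ ?_ ?_
  · intro j _
    have := j.2
    simp only [mem_Icc]
    omega
  · intro a _ b _ hab
    ext
    simp only [add_left_cancel_iff, add_right_cancel_iff, Nat.cast_inj] at hab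
    exact hab
  · intro t ht
    simp only [mem_Icc] at ht
    exact ⟨⟨(t - m - 1).toNat, by omega⟩, mem_univ _, by simp only; omega⟩
  · intros; rfl

theorem sum_fin_sub (r : ℕ) (h : ℤ → ℝ) (m : ℤ) :
    ∑ j : Fin r, h (m - ((j : ℕ) + 1)) = ∑ t ∈ Icc (m - r) (m - 1), h t := by
  refine sum_bij (fun j _ => m - ((j : ℕ) + 1)) ?_ ?_ ?_ ?_
  · intro j _
    have := j.2
    simp only [mem_Icc]
    omega
  · intro a _ b _ hab
    ext
    simp only [sub_right_inj, add_right_cancel_iff, Nat.cast_inj] at hab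
    exact hab
  · intro t ht
    simp only [mem_Icc] at ht
    exact ⟨⟨(m - t - 1).toNat, by omega⟩, mem_univ _, by simp only; omega⟩
  · intros; rfl

theorem nbrSum_eq (r : ℕ) (h : ℤ → ℝ) (s : ℤ) :
    nbrSum r h s = ∑ j : Fin r, h (s + ((j : ℕ) + 1)) + ∑ j : Fin r, h (s - ((j : ℕ) + 1)) := by
  rw [sum_fin_add, sum_fin_sub, add_comm, nbrSum, ← sum_union]
  · congr 1
    ext t
    simp only [mem_erase, mem_Icc, mem_union]
    omega
  · rw [disjoint_left]
    intro t
    simp only [mem_Icc]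
    omega

/-! ### Exchanging two sequences for their maximum and minimum. -/

/-- If the two differences have the same sign, the exchange only relabels the two bonds. If they
have opposite signs it uncrosses them, and the mixed difference over the rectangle is the gain. -/
theorem HasPairBounds.max_min_le {C lam : ℝ} {f : ℝ → ℝ → ℝ} (hf : HasPairBounds C lam f)
    (a a' b b' : ℝ) :
    f (max a a') (max b b') + f (min a a') (min b b') ≤ f a b + f a' b'
      - lam * (max (a - a') 0 * max (b' - b) 0 + max (a' - a) 0 * max (b - b') 0) := by
  rcases le_total a a' with h | h <;> rcases le_total b b' with h' | h' <;>
    simp only [max_eq_left h, max_eq_right h, min_eq_left h, min_eq_right h, max_eq_left h',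
      max_eq_right h', min_eq_left h', min_eq_right h', max_eq_left (sub_nonneg.2 h),
      max_eq_right (sub_nonpos.2 h), max_eq_left (sub_nonneg.2 h'), max_eq_right (sub_nonpos.2 h')]
  · linarith
  · have := hf.lower _ _ _ _ h h'
    linarith
  · have := hf.lower _ _ _ _ h h'
    linarith
  · linarith

/-- This is the bond leaving the segment at its right end, where only the first site is exchanged.
Energy can be lost only if the second sequence is above the first at both sites. -/
theorem HasPairBounds.max_min_left_le {C lam : ℝ} {f : ℝ → ℝ → ℝ} (hf : HasPairBounds C lam f)
    (hl : 0 ≤ lam) (a a' b b' : ℝ) :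
    f (max a a') b + f (min a a') b' ≤ f a b + f a' b'
      + C * (max (a' - a) 0 * max (b' - b) 0) := by
  rcases le_total a a' with h | h <;> rcases le_total b b' with h' | h' <;>
    simp only [max_eq_left h, max_eq_right h, min_eq_left h, min_eq_right h,
      max_eq_left (sub_nonneg.2 h),
      max_eq_right (sub_nonpos.2 h), max_eq_left (sub_nonneg.2 h'), max_eq_right (sub_nonpos.2 h')]
  · have := hf.upper _ _ _ _ h h'
    linarith
  · have := hf.lower _ _ _ _ h h'
    have := mul_nonneg hl (mul_nonneg (sub_nonneg.2 h) (sub_nonneg.2 h'))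
    linarith
  · linarith
  · linarith

theorem HasPairBounds.max_min_right_le {C lam : ℝ} {f : ℝ → ℝ → ℝ} (hf : HasPairBounds C lam f)
    (hl : 0 ≤ lam) (a a' b b' : ℝ) :
    f a (max b b') + f a' (min b b') ≤ f a b + f a' b'
      + C * (max (a' - a) 0 * max (b' - b) 0) := by
  rcases le_total a a' with h | h <;> rcases le_total b b' with h' | h' <;>
    simp only [max_eq_left h', max_eq_right h', min_eq_left h', min_eq_right h',
      max_eq_left (sub_nonneg.2 h),
      max_eq_right (sub_nonpos.2 h), max_eq_left (sub_nonneg.2 h'), max_eq_right (sub_nonpos.2 h')]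
  · have := hf.upper _ _ _ _ h h'
    linarith
  · linarith
  · have := hf.lower _ _ _ _ h h'
    have := mul_nonneg hl (mul_nonneg (sub_nonneg.2 h) (sub_nonneg.2 h'))
    linarith
  · linarith

/-- Compare the increment of `f` at `a` against `b` with the one at `a'` against `b'`: changing `b`
to `b'` is a mixed difference, changing `a` to `a'` a second difference in the same variable. -/
theorem HasPairBounds.spread_left_le {C lam : ℝ} {f : ℝ → ℝ → ℝ} (hf : HasPairBounds C lam f)
    (a a' b b' σ : ℝ) (hσ : 0 ≤ σ) :
    f (a + σ) b + f (a' - σ) b' ≤ f a b + f a' b'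
      - σ * (lam * max (b - b') 0 - C * max (b' - b) 0 - C * (|a - a'| + 2 * σ)) := by
  have h2 := hf.second_left a a' b' σ hσ
  rcases le_total b b' with h' | h' <;>
    simp only [max_eq_left (sub_nonneg.2 h'), max_eq_right (sub_nonpos.2 h')]
  · have := hf.upper a (a + σ) _ _ (by linarith) h'
    linarith
  · have := hf.lower a (a + σ) _ _ (by linarith) h'
    linarith

theorem HasPairBounds.spread_right_le {C lam : ℝ} {f : ℝ → ℝ → ℝ} (hf : HasPairBounds C lam f)
    (a a' b b' σ : ℝ) (hσ : 0 ≤ σ) :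
    f b (a + σ) + f b' (a' - σ) ≤ f b a + f b' a'
      - σ * (lam * max (b - b') 0 - C * max (b' - b) 0 - C * (|a - a'| + 2 * σ)) := by
  have h2 := hf.second_right a a' b' σ hσ
  rcases le_total b b' with h' | h' <;>
    simp only [max_eq_left (sub_nonneg.2 h'), max_eq_right (sub_nonpos.2 h')]
  · have := hf.upper _ _ a (a + σ) h' (by linarith)
    linarith
  · have := hf.lower _ _ a (a + σ) h' (by linarith)
    linarith

/-- Replace `x` by `max x y` on the segment `[i₀, i₁]`. -/
noncomputable def maxOn (i₀ i₁ : ℤ) (x y : ℤ → ℝ) (t : ℤ) : ℝ :=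
  if t ∈ Icc i₀ i₁ then max (x t) (y t) else x t

/-- Replace `y` by `min x y` on the segment `[i₀, i₁]`. -/
noncomputable def minOn (i₀ i₁ : ℤ) (x y : ℤ → ℝ) (t : ℤ) : ℝ :=
  if t ∈ Icc i₀ i₁ then min (x t) (y t) else y t

/-- The weight of the change of sign of `x - y` between `i` and `i + 1`. -/
noncomputable def crossWeight (x y : ℤ → ℝ) (i : ℤ) : ℝ :=
  excess x y i * excess y x (i + 1) + excess y x i * excess x y (i + 1)

theorem pairEnergy_exchange_le {r : ℕ} {C lam : ℝ} {f : Fin r → ℝ → ℝ → ℝ}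
    (hf : ∀ j, HasPairBounds C lam (f j)) (hr : 1 ≤ r) (hC : 0 ≤ C) (hl : 0 ≤ lam)
    (x y : ℤ → ℝ) (i₀ i₁ : ℤ) (T : Finset ℤ) (hT : T ⊆ Ico i₀ i₁) (m : ℤ) (hm : m ≤ i₁) :
    pairEnergy f m (maxOn i₀ i₁ x y) + pairEnergy f m (minOn i₀ i₁ x y) ≤
      pairEnergy f m x + pairEnergy f m y - lam * (if m ∈ T then crossWeight x y m else 0)
      + C * (if m < i₀ then excess y x m * windowSum r (excess y x) i₀ else 0)
      + C * (if i₁ - r < m then excess y x m * windowSum r (excess y x) i₁ else 0) := by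
  have hn := excess_nonneg y x
  set n := excess y x with hn'
  -- Only the nearest-neighbour bond `j = 0` is asked to supply the crossing gain; the indicators in
  -- the two costs mark bonds over the left and the right end.
  have key : ∀ j : Fin r,
      f j (maxOn i₀ i₁ x y m) (maxOn i₀ i₁ x y (m + ((j : ℕ) + 1)))
        + f j (minOn i₀ i₁ x y m) (minOn i₀ i₁ x y (m + ((j : ℕ) + 1))) ≤
      f j (x m) (x (m + ((j : ℕ) + 1))) + f j (y m) (y (m + ((j : ℕ) + 1)))
      - lam * (if m ∈ T ∧ (⟨0, hr⟩ : Fin r) = j then crossWeight x y m else 0)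
      + C * ((if m < i₀ then n m else 0) *
          (if i₀ ≤ m + ((j : ℕ) + 1) then n (m + ((j : ℕ) + 1)) else 0))
      + C * ((if i₁ - r < m then n m else 0) *
          (if i₁ ≤ m + ((j : ℕ) + 1) then n (m + ((j : ℕ) + 1)) else 0)) := by
    intro j
    have hjr := j.2
    have e1 : 0 ≤ C * ((if m < i₀ then n m else 0) *
          (if i₀ ≤ m + ((j : ℕ) + 1) then n (m + ((j : ℕ) + 1)) else 0)) := by
      refine mul_nonneg hC (mul_nonneg ?_ ?_) <;> split_ifs <;> first | exact hn _ | exact le_rfl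
    have e2 : 0 ≤ C * ((if i₁ - r < m then n m else 0) *
          (if i₁ ≤ m + ((j : ℕ) + 1) then n (m + ((j : ℕ) + 1)) else 0)) := by
      refine mul_nonneg hC (mul_nonneg ?_ ?_) <;> split_ifs <;> first | exact hn _ | exact le_rfl
    by_cases hmJ : m ∈ Icc i₀ i₁ <;> by_cases htJ : m + ((j : ℕ) + 1 : ℤ) ∈ Icc i₀ i₁
    · have := (hf j).max_min_le (x m) (y m) (x (m + ((j : ℕ) + 1))) (y (m + ((j : ℕ) + 1)))
      simp only [maxOn, minOn, if_pos hmJ, if_pos htJ]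
      have h3 : lam * (if m ∈ T ∧ (⟨0, hr⟩ : Fin r) = j then crossWeight x y m else 0) ≤
          lam * (excess x y m * excess y x (m + ((j : ℕ) + 1))
            + excess y x m * excess x y (m + ((j : ℕ) + 1))) := by
        refine mul_le_mul_of_nonneg_left ?_ hl
        split_ifs with h
        · rw [← h.2]
          simp [crossWeight]
        · exact add_nonneg (mul_nonneg (excess_nonneg _ _ _) (excess_nonneg _ _ _))
            (mul_nonneg (excess_nonneg _ _ _) (excess_nonneg _ _ _))
      unfold excess at h3
      linarith
    · have hT' : ¬ (m ∈ T ∧ (⟨0, hr⟩ : Fin r) = j) := by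
        rintro ⟨h1, h2⟩
        have := hT h1
        rw [← h2] at htJ
        simp only [mem_Ico, mem_Icc, not_and, not_le] at this htJ
        push_cast at htJ
        omega
      have := (hf j).max_min_left_le hl (x m) (y m) (x (m + ((j : ℕ) + 1)))
        (y (m + ((j : ℕ) + 1)))
      simp only [mem_Icc, not_and, not_le] at hmJ htJ
      have ht := htJ (by omega)
      rw [if_pos (by omega : i₁ - r < m), if_pos (by omega : i₁ ≤ m + ((j : ℕ) + 1 : ℤ))] at e2 ⊢
      simp only [maxOn, minOn, if_neg hT', mem_Icc, if_pos hmJ,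
        if_neg (show ¬ (i₀ ≤ m + ((j : ℕ) + 1 : ℤ) ∧ m + ((j : ℕ) + 1 : ℤ) ≤ i₁) by omega)]
      simp only [hn', excess] at e1 e2 ⊢
      linarith
    · have hT' : ¬ (m ∈ T ∧ (⟨0, hr⟩ : Fin r) = j) := by
        rintro ⟨h1, h2⟩
        have := hT h1
        simp only [mem_Ico, mem_Icc] at this hmJ
        omega
      have := (hf j).max_min_right_le hl (x m) (y m) (x (m + ((j : ℕ) + 1)))
        (y (m + ((j : ℕ) + 1)))
      simp only [mem_Icc] at hmJ htJ
      rw [if_pos (by omega : m < i₀), if_pos (by omega : i₀ ≤ m + ((j : ℕ) + 1 : ℤ))] at e1 ⊢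
      simp only [maxOn, minOn, if_neg hT', mem_Icc, if_neg hmJ, if_pos htJ]
      simp only [hn', excess] at e1 e2 ⊢
      linarith
    · have hT' : ¬ (m ∈ T ∧ (⟨0, hr⟩ : Fin r) = j) := by
        rintro ⟨h1, h2⟩
        have := hT h1
        simp only [mem_Ico, mem_Icc] at this hmJ
        omega
      simp only [maxOn, minOn, if_neg hT', if_neg hmJ, if_neg htJ]
      linarith
  have bound : ∀ c : ℤ, m ≤ c →
      ∑ j : Fin r, (if c ≤ m + ((j : ℕ) + 1) then n (m + ((j : ℕ) + 1)) else 0) ≤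
      windowSum r n c := by
    intro c hc
    rw [sum_fin_add r (fun t => if c ≤ t then n t else 0) m, ← sum_filter]
    refine sum_le_sum_of_subset_of_nonneg (fun t ht => ?_) fun t _ _ => hn t
    simp only [mem_filter, mem_Icc] at ht ⊢
    omega
  unfold pairEnergy
  rw [← sum_add_distrib, ← sum_add_distrib]
  refine (sum_le_sum fun j _ => key j).trans ?_
  rw [sum_add_distrib, sum_add_distrib, sum_sub_distrib, ← mul_sum, ← mul_sum, ← mul_sum,
    ← mul_sum, ← mul_sum]
  have s1 : ∑ j : Fin r, (if m ∈ T ∧ (⟨0, hr⟩ : Fin r) = j then crossWeight x y m else 0) =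
      if m ∈ T then crossWeight x y m else 0 := by
    by_cases h : m ∈ T <;> simp [h]
  rw [s1]
  refine add_le_add (add_le_add le_rfl (mul_le_mul_of_nonneg_left ?_ hC))
    (mul_le_mul_of_nonneg_left ?_ hC)
  · split_ifs with h
    · exact mul_le_mul_of_nonneg_left (bound _ h.le) (hn m)
    · simp
  · split_ifs with h
    · exact mul_le_mul_of_nonneg_left (bound _ hm) (hn m)
    · simp

/-- Bonds over an end cost products of two excesses at sites within distance `r` of it, so their sum
is at most the square of a window sum. -/
theorem energyOn_exchange_le {r : ℕ} {C lam : ℝ} {f : Fin r → ℝ → ℝ → ℝ}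
    (hf : ∀ j, HasPairBounds C lam (f j)) (hr : 1 ≤ r) (hC : 0 ≤ C) (hl : 0 ≤ lam)
    (x y : ℤ → ℝ) (i₀ i₁ : ℤ) (T : Finset ℤ) (hT : T ⊆ Ico i₀ i₁) :
    energyOn f (i₀ - r) i₁ (maxOn i₀ i₁ x y) + energyOn f (i₀ - r) i₁ (minOn i₀ i₁ x y) ≤
      energyOn f (i₀ - r) i₁ x + energyOn f (i₀ - r) i₁ y - lam * ∑ i ∈ T, crossWeight x y i
      + C * (windowSum r (excess y x) i₀ ^ 2 + windowSum r (excess y x) i₁ ^ 2) := by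
  have hn := excess_nonneg y x
  unfold energyOn
  rw [← sum_add_distrib, ← sum_add_distrib]
  refine (sum_le_sum fun m hm => pairEnergy_exchange_le hf hr hC hl x y i₀ i₁ T hT m
    (mem_Icc.1 hm).2).trans ?_
  rw [sum_add_distrib, sum_add_distrib, sum_sub_distrib, ← mul_sum, ← mul_sum, ← mul_sum]
  have s1 : ∑ m ∈ Icc (i₀ - r) i₁, (if m ∈ T then crossWeight x y m else 0) =
      ∑ i ∈ T, crossWeight x y i := by
    rw [← sum_filter]
    congr 1
    ext m
    simp only [mem_filter, mem_Icc, and_iff_right_iff_imp]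
    intro h
    have := mem_Ico.1 (hT h)
    omega
  have s2 : ∑ m ∈ Icc (i₀ - r) i₁,
      (if m < i₀ then excess y x m * windowSum r (excess y x) i₀ else 0) ≤
      windowSum r (excess y x) i₀ ^ 2 := by
    rw [← sum_filter, ← sum_mul, sq]
    refine mul_le_mul_of_nonneg_right ?_ (windowSum_nonneg r hn _)
    refine sum_le_sum_of_subset_of_nonneg (fun t ht => ?_) fun t _ _ => hn t
    simp only [mem_filter, mem_Icc] at ht ⊢
    omega
  have s3 : ∑ m ∈ Icc (i₀ - r) i₁,
      (if i₁ - r < m then excess y x m * windowSum r (excess y x) i₁ else 0) ≤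
      windowSum r (excess y x) i₁ ^ 2 := by
    rw [← sum_filter, ← sum_mul, sq]
    refine mul_le_mul_of_nonneg_right ?_ (windowSum_nonneg r hn _)
    refine sum_le_sum_of_subset_of_nonneg (fun t ht => ?_) fun t _ _ => hn t
    simp only [mem_filter, mem_Icc] at ht ⊢
    omega
  rw [s1]
  have := mul_le_mul_of_nonneg_left s2 hC
  have := mul_le_mul_of_nonneg_left s3 hC
  linarith

/-! ### Spreading two sequences apart at one site. -/

/-- Raising `X` and lowering `Y` by `σ` at the site `s`. -/
theorem energyOn_spread_le {r : ℕ} {C lam : ℝ} {f : Fin r → ℝ → ℝ → ℝ}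
    (hf : ∀ j, HasPairBounds C lam (f j)) (X Y : ℤ → ℝ) (s a b : ℤ) (σ : ℝ) (hσ : 0 ≤ σ)
    (ha : a ≤ s - r) (hb : s ≤ b) :
    energyOn f a b (Function.update X s (X s + σ)) + energyOn f a b (Function.update Y s (Y s - σ)) ≤
      energyOn f a b X + energyOn f a b Y
      - σ * (lam * nbrSum r (excess X Y) s - C * nbrSum r (excess Y X) s
        - 2 * r * C * (|X s - Y s| + 2 * σ)) := by
  set g : ℤ → ℝ := fun t => -(σ * (lam * excess X Y t - C * excess Y X t
    - C * (|X s - Y s| + 2 * σ))) with hg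
  have key : ∀ (m : ℤ) (j : Fin r),
      f j (Function.update X s (X s + σ) m) (Function.update X s (X s + σ) (m + ((j : ℕ) + 1)))
      + f j (Function.update Y s (Y s - σ) m) (Function.update Y s (Y s - σ) (m + ((j : ℕ) + 1))) ≤
      f j (X m) (X (m + ((j : ℕ) + 1))) + f j (Y m) (Y (m + ((j : ℕ) + 1)))
      + ((if m = s then g (s + ((j : ℕ) + 1)) else 0)
      + (if m = s - ((j : ℕ) + 1) then g (s - ((j : ℕ) + 1)) else 0)) := by
    intro m j
    by_cases h1 : m = s
    · subst h1
      have hne : m + ((j : ℕ) + 1 : ℤ) ≠ m := by omega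
      rw [if_pos rfl, if_neg (by omega), Function.update_of_ne hne, Function.update_of_ne hne,
        Function.update_self, Function.update_self]
      have := (hf j).spread_left_le (X m) (Y m) (X (m + ((j : ℕ) + 1))) (Y (m + ((j : ℕ) + 1))) σ hσ
      simp only [hg, excess]
      linarith
    · by_cases h2 : m = s - ((j : ℕ) + 1)
      · have hs : m + ((j : ℕ) + 1 : ℤ) = s := by omega
        rw [if_neg h1, if_pos h2, ← h2, hs, Function.update_of_ne h1, Function.update_of_ne h1,
          Function.update_self, Function.update_self]
        have := (hf j).spread_right_le (X s) (Y s) (X m) (Y m) σ hσ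
        simp only [hg, excess]
        linarith
      · have hs : m + ((j : ℕ) + 1 : ℤ) ≠ s := by omega
        rw [if_neg h1, if_neg h2, Function.update_of_ne h1, Function.update_of_ne h1,
          Function.update_of_ne hs, Function.update_of_ne hs]
        linarith
  have tot : energyOn f a b (Function.update X s (X s + σ))
      + energyOn f a b (Function.update Y s (Y s - σ)) ≤
      energyOn f a b X + energyOn f a b Y + nbrSum r g s := by
    unfold energyOn pairEnergy
    rw [← sum_add_distrib, ← sum_add_distrib]
    simp only [← sum_add_distrib]
    refine (sum_le_sum fun m _ => sum_le_sum fun j _ => key m j).trans (le_of_eq ?_)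
    simp only [sum_add_distrib]
    rw [nbrSum_eq]
    congr 1
    congr 1
    · rw [sum_comm]
      refine sum_congr rfl fun j _ => ?_
      rw [sum_ite_eq']
      rw [if_pos]
      simp only [mem_Icc]
      omega
    · rw [sum_comm]
      refine sum_congr rfl fun j _ => ?_
      rw [sum_ite_eq', if_pos]
      have := j.2
      simp only [mem_Icc]
      omega
  have card : (((Icc (s - r) (s + r)).erase s).card : ℝ) = 2 * r := by
    rw [card_erase_of_mem (by simp), Int.card_Icc]
    have : (s + r + 1 - (s - r)).toNat - 1 = 2 * r := by omega
    rw [this]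
    push_cast
    ring
  have hsum : nbrSum r g s = - (σ * (lam * nbrSum r (excess X Y) s - C * nbrSum r (excess Y X) s
        - 2 * r * C * (|X s - Y s| + 2 * σ))) := by
    simp only [nbrSum, hg]
    rw [sum_neg_distrib, ← mul_sum, sum_sub_distrib, sum_sub_distrib, ← mul_sum, ← mul_sum,
      sum_const, nsmul_eq_mul, card]
    ring
  linarith

/-- Spreading `x` and `y` themselves cannot gain energy; dividing by `σ` and letting `σ` tend to
zero gives an inequality form of the difference of the two stationarity equations at `s`. -/
theorem IsPairMinimizer.nbrSum_le {r : ℕ} {C lam : ℝ} {f : Fin r → ℝ → ℝ → ℝ}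
    (hf : ∀ j, HasPairBounds C lam (f j)) {x y : ℤ → ℝ} (hx : IsPairMinimizer f x)
    (hy : IsPairMinimizer f y) (hC : 0 ≤ C) (s : ℤ) :
    lam * nbrSum r (excess x y) s ≤ C * nbrSum r (excess y x) s + 2 * r * C * |x s - y s| := by
  refine le_of_forall_pos_le_add fun ε hε => ?_
  -- With `σ = ε / B` the second-order error `4 * r * C * σ` is at most `ε`; the summand `1` keeps
  -- `B` positive if `C = 0`.
  set B : ℝ := 2 * r * C * 2 + 1 with hB
  have hB0 : 0 < B := by positivity
  have hσ : 0 < ε / B := div_pos hε hB0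
  have h1 := energyOn_spread_le hf x y s (s - r) s (ε / B) hσ.le le_rfl le_rfl
  have h2 := hx s s (Function.update x s (x s + ε / B)) le_rfl (fun i hi =>
    Function.update_of_ne (by simpa using hi) _ _)
  have h3 := hy s s (Function.update y s (y s - ε / B)) le_rfl (fun i hi =>
    Function.update_of_ne (by simpa using hi) _ _)
  have h4 : ε / B * (lam * nbrSum r (excess x y) s - C * nbrSum r (excess y x) s
        - 2 * r * C * (|x s - y s| + 2 * (ε / B))) ≤ 0 := by linarith
  have h5 := nonpos_of_mul_nonpos_right h4 hσ
  have h6 : 2 * r * C * (2 * (ε / B)) ≤ ε := by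
    have : B * (ε / B) = ε := by field_simp
    nlinarith
  linarith

/-! ### Growth of the difference of two minimizers. -/

/-- The size of `x - y` on the `2 r` sites within distance `r` of both `i` and `i + 1`. -/
noncomputable def localSize (r : ℕ) (x y : ℤ → ℝ) (i : ℤ) : ℝ :=
  ∑ t ∈ Icc (i - r + 1) (i + r), |x t - y t|

theorem localSize_nonneg (r : ℕ) (x y : ℤ → ℝ) (i : ℤ) : 0 ≤ localSize r x y i :=
  sum_nonneg fun _ _ => abs_nonneg _

theorem localSize_comm (r : ℕ) (x y : ℤ → ℝ) (i : ℤ) : localSize r x y i = localSize r y x i :=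
  sum_congr rfl fun _ _ => abs_sub_comm _ _

theorem abs_le_localSize {r : ℕ} (x y : ℤ → ℝ) {i t : ℤ} (h : i - r + 1 ≤ t) (h' : t ≤ i + r) :
    |x t - y t| ≤ localSize r x y i :=
  single_le_sum (f := fun t => |x t - y t|) (fun _ _ => abs_nonneg _) (mem_Icc.2 ⟨h, h'⟩)

/-- The twist gives the site `t` the coefficient `lam` in the inequality at its neighbour `s`, which
can thus be solved for `t`, like a recursion with leading coefficient bounded away from zero. -/
theorem IsPairMinimizer.abs_sub_le {r : ℕ} {C lam : ℝ} {f : Fin r → ℝ → ℝ → ℝ}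
    (hf : ∀ j, HasPairBounds C lam (f j)) {x y : ℤ → ℝ} (hx : IsPairMinimizer f x)
    (hy : IsPairMinimizer f y) (hC : 0 ≤ C) (hl : 0 ≤ lam) {s t : ℤ}
    (ht : t ∈ (Icc (s - r) (s + r)).erase s) :
    lam * |x t - y t| ≤ (C + 2 * r * C) * ∑ i ∈ (Icc (s - r) (s + r)).erase t, |x i - y i| := by
  wlog h : y t ≤ x t generalizing x y
  · have := this hy hx (le_of_not_ge h)
    simpa only [abs_sub_comm] using this
  have h1 := hx.nbrSum_le hf hy hC s
  have h2 : |x t - y t| ≤ nbrSum r (excess x y) s := by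
    have : |x t - y t| = excess x y t := by
      rw [← excess_add_excess, excess_eq_zero h, add_zero]
    rw [this]
    exact single_le_sum (f := excess x y) (fun _ _ => excess_nonneg _ _ _) ht
  have hts := (mem_erase.1 ht).1
  -- Since `y t ≤ x t`, the excess of `y` over `x` vanishes at `t`, so `t` may be omitted on the
  -- right.
  have h3 : nbrSum r (excess y x) s ≤ ∑ i ∈ (Icc (s - r) (s + r)).erase t, |x i - y i| := by
    unfold nbrSum
    rw [← add_sum_erase _ _ ht, excess_eq_zero h, zero_add]
    refine (sum_le_sum fun i _ => (excess_le_abs y x i).trans_eq (abs_sub_comm _ _)).trans ?_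
    refine sum_le_sum_of_subset_of_nonneg (fun i hi => ?_) fun i _ _ => abs_nonneg _
    simp only [mem_erase] at hi ⊢
    tauto
  have h4 : |x s - y s| ≤ ∑ i ∈ (Icc (s - r) (s + r)).erase t, |x i - y i| :=
    single_le_sum (f := fun i => |x i - y i|) (fun _ _ => abs_nonneg _)
      (mem_erase.2 ⟨hts.symm, by simp⟩)
  have h5 := mul_le_mul_of_nonneg_left h2 hl
  have h6 := mul_le_mul_of_nonneg_left h3 hC
  have h7 := mul_le_mul_of_nonneg_left h4 (by positivity : (0 : ℝ) ≤ 2 * r * C)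
  linarith

/-- The factor by which `localSize` may change between neighbouring sites. -/
noncomputable def growthFactor (r : ℕ) (C lam : ℝ) : ℝ := 1 + (C + 2 * r * C) / lam

theorem one_le_growthFactor {r : ℕ} {C lam : ℝ} (hC : 0 ≤ C) (hl : 0 < lam) :
    1 ≤ growthFactor r C lam := by
  unfold growthFactor
  have : 0 ≤ (C + 2 * r * C) / lam := by positivity
  linarith

theorem IsPairMinimizer.localSize_succ_le {r : ℕ} {C lam : ℝ} {f : Fin r → ℝ → ℝ → ℝ}
    (hf : ∀ j, HasPairBounds C lam (f j)) {x y : ℤ → ℝ} (hx : IsPairMinimizer f x)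
    (hy : IsPairMinimizer f y) (hr : 1 ≤ r) (hC : 0 ≤ C) (hl : 0 < lam) (i : ℤ) :
    localSize r x y (i + 1) ≤ growthFactor r C lam * localSize r x y i := by
  have h := hx.abs_sub_le hf hy hC hl.le (s := i + 1) (t := i + 1 + r) (by
    simp only [mem_erase, mem_Icc]; omega)
  have e : (Icc (i + 1 - r) (i + 1 + r)).erase (i + 1 + r) = Icc (i - r + 1) (i + r) := by
    ext t; simp only [mem_erase, mem_Icc]; omega
  rw [e, mul_comm, ← le_div_iff₀ hl] at h
  have h2 : localSize r x y (i + 1) ≤ |x (i + 1 + r) - y (i + 1 + r)| + localSize r x y i := by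
    unfold localSize
    rw [← sum_insert (f := fun t => |x t - y t|) (by simp)]
    refine sum_le_sum_of_subset_of_nonneg (fun t ht => ?_) fun _ _ _ => abs_nonneg _
    simp only [mem_insert, mem_Icc] at ht ⊢
    omega
  refine h2.trans ((add_le_add_left h _).trans (le_of_eq ?_))
  unfold growthFactor localSize
  ring

theorem IsPairMinimizer.localSize_le_succ {r : ℕ} {C lam : ℝ} {f : Fin r → ℝ → ℝ → ℝ}
    (hf : ∀ j, HasPairBounds C lam (f j)) {x y : ℤ → ℝ} (hx : IsPairMinimizer f x)
    (hy : IsPairMinimizer f y) (hr : 1 ≤ r) (hC : 0 ≤ C) (hl : 0 < lam) (i : ℤ) :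
    localSize r x y i ≤ growthFactor r C lam * localSize r x y (i + 1) := by
  have h := hx.abs_sub_le hf hy hC hl.le (s := i + 1) (t := i + 1 - r) (by
    simp only [mem_erase, mem_Icc]; omega)
  have e : (Icc (i + 1 - r) (i + 1 + r)).erase (i + 1 - r) = Icc (i + 1 - r + 1) (i + 1 + r) := by
    ext t; simp only [mem_erase, mem_Icc]; omega
  rw [e, mul_comm, ← le_div_iff₀ hl] at h
  have h2 : localSize r x y i ≤ |x (i + 1 - r) - y (i + 1 - r)| + localSize r x y (i + 1) := by
    unfold localSize
    rw [← sum_insert (f := fun t => |x t - y t|) (by simp)]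
    refine sum_le_sum_of_subset_of_nonneg (fun t ht => ?_) fun _ _ _ => abs_nonneg _
    simp only [mem_insert, mem_Icc] at ht ⊢
    omega
  refine h2.trans ((add_le_add_left h _).trans (le_of_eq ?_))
  unfold growthFactor localSize
  ring

theorem IsPairMinimizer.localSize_le_pow {r : ℕ} {C lam : ℝ} {f : Fin r → ℝ → ℝ → ℝ}
    (hf : ∀ j, HasPairBounds C lam (f j)) {x y : ℤ → ℝ} (hx : IsPairMinimizer f x)
    (hy : IsPairMinimizer f y) (hr : 1 ≤ r) (hC : 0 ≤ C) (hl : 0 < lam) (n : ℕ) :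
    ∀ i j : ℤ, |j - i| ≤ n → localSize r x y j ≤ growthFactor r C lam ^ n * localSize r x y i := by
  have hg := one_le_growthFactor (r := r) hC hl
  have hV := localSize_nonneg r x y
  induction n with
  | zero =>
    intro i j h
    have : j = i := by
      simp at h
      omega
    simp [this]
  | succ n ih =>
    intro i j h
    rw [abs_le] at h
    push_cast at h
    have key : ∀ k, |k - i| ≤ (n : ℤ) →
        localSize r x y j ≤ growthFactor r C lam * localSize r x y k →
        localSize r x y j ≤ growthFactor r C lam ^ (n + 1) * localSize r x y i := by
      intro k hk hjk
      refine hjk.trans ((mul_le_mul_of_nonneg_left (ih i k hk) (by linarith)).trans (le_of_eq ?_))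
      ring
    rcases lt_trichotomy j i with hji | hji | hji
    · exact key (j + 1) (abs_le.2 ⟨by omega, by omega⟩) (hx.localSize_le_succ hf hy hr hC hl j)
    · refine key j (abs_le.2 ⟨by omega, by omega⟩) ?_
      nlinarith [hV j]
    · have := hx.localSize_succ_le hf hy hr hC hl (j - 1)
      rw [sub_add_cancel] at this
      exact key (j - 1) (abs_le.2 ⟨by omega, by omega⟩) this

/-- The `2 * r + 1` sites of the window are covered by the blocks of `2 * r` sites belonging to `w`
and `w - 1`, both at distance at most `r + 1` from `i`. -/
theorem IsPairMinimizer.windowSum_le {r : ℕ} {C lam : ℝ} {f : Fin r → ℝ → ℝ → ℝ}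
    (hf : ∀ j, HasPairBounds C lam (f j)) {x y : ℤ → ℝ} (hx : IsPairMinimizer f x)
    (hy : IsPairMinimizer f y) (hr : 1 ≤ r) (hC : 0 ≤ C) (hl : 0 < lam) {i w : ℤ}
    (h : |w - i| ≤ r) :
    windowSum r (excess x y) w ≤ 2 * growthFactor r C lam ^ (r + 1) * localSize r x y i := by
  have h1 := hx.localSize_le_pow hf hy hr hC hl (r + 1) i w (h.trans (by simp))
  have h2 := hx.localSize_le_pow hf hy hr hC hl (r + 1) i (w - 1) (by
    rw [abs_le] at h ⊢; push_cast; omega)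
  have h3 : windowSum r (excess x y) w ≤ localSize r x y w + localSize r x y (w - 1) := by
    unfold windowSum
    refine (sum_le_sum fun t _ => excess_le_abs x y t).trans ?_
    unfold localSize
    have : Icc (w - r) (w + r) ⊆ Icc (w - r + 1) (w + r) ∪ Icc (w - 1 - r + 1) (w - 1 + r) := by
      intro t
      simp only [mem_union, mem_Icc]
      omega
    refine (sum_le_sum_of_subset_of_nonneg this fun _ _ _ => abs_nonneg _).trans ?_
    rw [← sum_union_inter]
    exact le_add_of_nonneg_right (sum_nonneg fun _ _ => abs_nonneg _)
  linarith

/-! ### The energy gained at crossings. -/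

/-- `x - y` changes sign weakly between `i` and `i + 1`. -/
def CrossesAt (x y : ℤ → ℝ) (i : ℤ) : Prop := (x i - y i) * (x (i + 1) - y (i + 1)) ≤ 0

theorem CrossesAt.symm {x y : ℤ → ℝ} {i : ℤ} (h : CrossesAt x y i) : CrossesAt y x i := by
  unfold CrossesAt at *
  linarith

/-- At a crossing, either the sign change itself or smoothing the corner of the maximum and the
minimum of `x` and `y` gains an amount of energy which is quadratic in the local size. -/
theorem exists_crossing_gain {r : ℕ} {C lam : ℝ} (hr : 1 ≤ r) (hC : 0 < C) (hl : 0 < lam) :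
    ∃ c > 0, ∀ (x y : ℤ → ℝ) (i : ℤ), CrossesAt x y i →
      c * localSize r x y i ^ 2 ≤ lam * crossWeight x y i ∨
      ∃ s, (s = i ∨ s = i + 1) ∧ ∃ σ, 0 ≤ σ ∧ c * localSize r x y i ^ 2 ≤
        σ * (lam * nbrSum r (fun t => |x t - y t|) s - 2 * r * C * (|x s - y s| + 2 * σ)) := by
  have hr0 : (0 : ℝ) < r := by exact_mod_cast hr
  -- A difference below `κ * L s` counts as small, and `η * L s` is then the spreading step: the two
  -- error terms use up `lam / 2` and `lam / 4` of the coefficient `lam`, leaving `lam / 4`.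
  set κ : ℝ := lam / (4 * r * C) with hκ
  set η : ℝ := lam / (16 * r * C) with hη
  have hκ0 : 0 < κ := by positivity
  have hη0 : 0 < η := by positivity
  have hκe : κ * (4 * r * C) = lam := by rw [hκ]; field_simp
  have hηe : η * (16 * r * C) = lam := by rw [hη]; field_simp
  set c₁ : ℝ := lam / (1 + 1 / κ) ^ 2
  set c₂ : ℝ := η * lam / 4 / (1 + κ) ^ 2
  refine ⟨min c₁ c₂, lt_min (by positivity) (by positivity), fun x y i h => ?_⟩
  set V := localSize r x y i with hV
  have hV0 : 0 ≤ V := localSize_nonneg r x y i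
  set L : ℤ → ℝ := nbrSum r (fun t => |x t - y t|) with hL
  have hL0 : ∀ s, 0 ≤ L s := fun s => sum_nonneg fun _ _ => abs_nonneg _
  have hVL : ∀ s, s = i ∨ s = i + 1 → V ≤ |x s - y s| + L s := by
    intro s hs
    have := windowSum_eq r (fun t => |x t - y t|) s
    rw [hL, ← this]
    refine sum_le_sum_of_subset_of_nonneg (fun t ht => ?_) fun _ _ _ => abs_nonneg _
    simp only [mem_Icc] at ht ⊢
    omega
  by_cases hs : ∃ s, (s = i ∨ s = i + 1) ∧ |x s - y s| ≤ κ * L s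
  · obtain ⟨s, hsi, hs⟩ := hs
    refine Or.inr ⟨s, hsi, η * L s, by have := hL0 s; positivity, ?_⟩
    have h1 : V ≤ (1 + κ) * L s := by linarith [hVL s hsi]
    have h2 : V ^ 2 ≤ (1 + κ) ^ 2 * L s ^ 2 := by
      rw [← mul_pow]; exact pow_le_pow_left₀ hV0 h1 2
    have h3 : min c₁ c₂ * V ^ 2 ≤ c₂ * V ^ 2 :=
      mul_le_mul_of_nonneg_right (min_le_right _ _) (sq_nonneg _)
    have h4 : c₂ * V ^ 2 ≤ c₂ * ((1 + κ) ^ 2 * L s ^ 2) :=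
      mul_le_mul_of_nonneg_left h2 (by positivity)
    have h5 : c₂ * ((1 + κ) ^ 2 * L s ^ 2) = η * lam / 4 * L s ^ 2 := by
      simp only [c₂]; field_simp
    have h6 : 2 * r * C * |x s - y s| ≤ 2 * r * C * (κ * L s) :=
      mul_le_mul_of_nonneg_left hs (by positivity)
    have h7 : η * lam / 4 * L s ^ 2 =
        η * L s * (lam * L s - 2 * r * C * (κ * L s + 2 * (η * L s))) := by
      linear_combination (η * L s ^ 2 / 2) * hκe + (η * L s ^ 2 / 4) * hηe
    have h8 : η * L s * (lam * L s - 2 * r * C * (κ * L s + 2 * (η * L s))) ≤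
        η * L s * (lam * L s - 2 * r * C * (|x s - y s| + 2 * (η * L s))) :=
      mul_le_mul_of_nonneg_left (by linarith) (by have := hL0 s; positivity)
    linarith
  · push Not at hs
    left
    have h0 := hs i (Or.inl rfl)
    have h1 := hs (i + 1) (Or.inr rfl)
    have hb : ∀ s, s = i ∨ s = i + 1 → V / (1 + 1 / κ) ≤ |x s - y s| := by
      intro s hsi
      have := hs s hsi
      rw [div_le_iff₀ (by positivity)]
      have h2 : L s ≤ |x s - y s| / κ := by
        rw [le_div_iff₀ hκ0]; linarith
      have h3 := hVL s hsi
      have h4 : |x s - y s| * (1 + 1 / κ) = |x s - y s| + |x s - y s| / κ := by ring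
      linarith
    -- A weak crossing could have a zero difference, but here both absolute differences exceed `κ *
    -- L ≥ 0`, so the signs are strictly opposite.
    have hcw : crossWeight x y i = |x i - y i| * |x (i + 1) - y (i + 1)| := by
      unfold CrossesAt at h
      unfold crossWeight excess
      rw [← neg_sub (x i) (y i), ← neg_sub (x (i + 1)) (y (i + 1))]
      rcases le_or_gt 0 (x i - y i) with hp | hp
      · have hp' : 0 < x i - y i := by
          rw [abs_of_nonneg hp] at h0
          exact lt_of_le_of_lt (mul_nonneg hκ0.le (hL0 i)) h0
        have hq : x (i + 1) - y (i + 1) ≤ 0 := nonpos_of_mul_nonpos_right h hp'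
        rw [max_eq_left hp, max_eq_right (by linarith : -(x i - y i) ≤ 0),
          max_eq_left (by linarith : 0 ≤ -(x (i + 1) - y (i + 1))), abs_of_nonneg hp,
          abs_of_nonpos hq]
        ring
      · have hq : 0 ≤ x (i + 1) - y (i + 1) := by
          by_contra hq
          push Not at hq
          nlinarith
        rw [max_eq_right hp.le, max_eq_left (by linarith : 0 ≤ -(x i - y i)), max_eq_left hq,
          abs_of_neg hp, abs_of_nonneg hq]
        ring
    rw [hcw]
    have h3 : min c₁ c₂ * V ^ 2 ≤ c₁ * V ^ 2 :=
      mul_le_mul_of_nonneg_right (min_le_left _ _) (sq_nonneg _)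
    have h4 : c₁ * V ^ 2 = lam * (V / (1 + 1 / κ) * (V / (1 + 1 / κ))) := by
      simp only [c₁]; field_simp
    have h5 := mul_le_mul (hb i (Or.inl rfl)) (hb (i + 1) (Or.inr rfl)) (by positivity)
      (abs_nonneg _)
    have h6 := mul_le_mul_of_nonneg_left h5 hl.le
    linarith

/-- A finite set of sites which are far from each other and from the ends of `[i₀, i₁]`. -/
def IsSparse (r : ℕ) (i₀ i₁ : ℤ) (T : Finset ℤ) : Prop :=
  (∀ i ∈ T, i₀ ≤ i - r ∧ i + 1 + r ≤ i₁) ∧ ∀ i ∈ T, ∀ j ∈ T, i < j → i + r + 2 ≤ j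

/-- Sparseness keeps the modified sites out of each other's windows of radius `r` and away from the
ends. Each spreading therefore still sees the unmodified max and min, and the gains add up. -/
theorem exists_smoothing {r : ℕ} {C lam : ℝ} {f : Fin r → ℝ → ℝ → ℝ}
    (hf : ∀ j, HasPairBounds C lam (f j)) (x y : ℤ → ℝ) {i₀ i₁ : ℤ} {c : ℝ} {s : ℤ → ℤ}
    (hs : ∀ i, s i = i ∨ s i = i + 1) (T : Finset ℤ) (hT : IsSparse r i₀ i₁ T)
    (hgain : ∀ i ∈ T, ∃ σ, 0 ≤ σ ∧ c * localSize r x y i ^ 2 ≤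
        σ * (lam * nbrSum r (fun t => |x t - y t|) (s i)
          - 2 * r * C * (|x (s i) - y (s i)| + 2 * σ))) :
    ∃ X Y : ℤ → ℝ, (∀ t, (∀ i ∈ T, t ≠ s i) → X t = maxOn i₀ i₁ x y t ∧ Y t = minOn i₀ i₁ x y t) ∧
      energyOn f (i₀ - r) i₁ X + energyOn f (i₀ - r) i₁ Y ≤
        energyOn f (i₀ - r) i₁ (maxOn i₀ i₁ x y) + energyOn f (i₀ - r) i₁ (minOn i₀ i₁ x y)
        - c * ∑ i ∈ T, localSize r x y i ^ 2 := by
  induction T using Finset.induction_on with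
  | empty => exact ⟨_, _, fun t _ => ⟨rfl, rfl⟩, by simp⟩
  | insert i T hi ih =>
    obtain ⟨X, Y, hXY, hE⟩ := ih ⟨fun j hj => hT.1 j (mem_insert_of_mem hj),
      fun j hj k hk => hT.2 j (mem_insert_of_mem hj) k (mem_insert_of_mem hk)⟩
      (fun j hj => hgain j (mem_insert_of_mem hj))
    obtain ⟨σ, hσ, hg⟩ := hgain i (mem_insert_self _ _)
    have hbd := hT.1 i (mem_insert_self _ _)
    have near : ∀ t ∈ Icc (s i - r) (s i + r), X t = max (x t) (y t) ∧ Y t = min (x t) (y t) := by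
      intro t ht
      have htJ : t ∈ Icc i₀ i₁ := by
        simp only [mem_Icc] at ht ⊢
        have := hs i
        omega
      have := hXY t (fun j hj htj => by
        have hne : i ≠ j := fun h => hi (h ▸ hj)
        simp only [mem_Icc] at ht
        have h1 := hs i
        have h2 := hs j
        rcases lt_or_gt_of_ne hne with h | h
        · have := hT.2 i (mem_insert_self _ _) j (mem_insert_of_mem hj) h
          omega
        · have := hT.2 j (mem_insert_of_mem hj) i (mem_insert_self _ _) h
          omega)
      simpa only [maxOn, minOn, if_pos htJ] using this
    refine ⟨Function.update X (s i) (X (s i) + σ), Function.update Y (s i) (Y (s i) - σ), ?_, ?_⟩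
    · intro t ht
      have hti := ht i (mem_insert_self _ _)
      rw [Function.update_of_ne hti, Function.update_of_ne hti]
      exact hXY t fun j hj => ht j (mem_insert_of_mem hj)
    · have h1 := energyOn_spread_le hf X Y (s i) (i₀ - r) i₁ σ hσ
        (by have := hs i; omega) (by have := hs i; omega)
      have hd : ∀ t ∈ Icc (s i - r) (s i + r), X t - Y t = |x t - y t| := fun t ht => by
        rw [(near t ht).1, (near t ht).2, max_sub_min_eq_abs']
      have e1 : nbrSum r (excess X Y) (s i) = nbrSum r (fun t => |x t - y t|) (s i) :=
        sum_congr rfl fun t ht => by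
          rw [excess, hd t (mem_of_mem_erase ht), max_eq_left (abs_nonneg _)]
      have e2 : nbrSum r (excess Y X) (s i) = 0 :=
        sum_eq_zero fun t ht => excess_eq_zero (by
          have := hd t (mem_of_mem_erase ht)
          have := abs_nonneg (x t - y t)
          linarith)
      have e3 : |X (s i) - Y (s i)| = |x (s i) - y (s i)| := by
        rw [hd (s i) (by simp), abs_abs]
      rw [e1, e2, e3] at h1
      rw [sum_insert hi]
      linarith

/-- The main energy inequality: the sizes at crossings are controlled by the negative parts of
`x - y` near the two ends of the segment. -/
theorem exists_crossing_bound {r : ℕ} {C lam : ℝ} (hr : 1 ≤ r) (hC : 0 < C) (hl : 0 < lam) :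
    ∃ c > 0, ∀ f : Fin r → ℝ → ℝ → ℝ, (∀ j, HasPairBounds C lam (f j)) → ∀ x y : ℤ → ℝ,
      IsPairMinimizer f x → IsPairMinimizer f y → ∀ (i₀ i₁ : ℤ) (T : Finset ℤ),
      IsSparse r i₀ i₁ T → (∀ i ∈ T, CrossesAt x y i) → i₀ ≤ i₁ →
      c * ∑ i ∈ T, localSize r x y i ^ 2 ≤
        windowSum r (excess y x) i₀ ^ 2 + windowSum r (excess y x) i₁ ^ 2 := by
  classical
  obtain ⟨c, hc, hgain⟩ := exists_crossing_gain (r := r) hr hC hl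
  refine ⟨c / C, by positivity, fun f hf x y hx hy i₀ i₁ T hT hcr h01 => ?_⟩
  -- On `A` the exchange alone gains enough; on `B` the corner must be smoothed afterwards.
  set A := T.filter fun i => c * localSize r x y i ^ 2 ≤ lam * crossWeight x y i with hA
  set B := T.filter fun i => ¬ c * localSize r x y i ^ 2 ≤ lam * crossWeight x y i with hB
  have hsplit : ∑ i ∈ T, localSize r x y i ^ 2 =
      ∑ i ∈ A, localSize r x y i ^ 2 + ∑ i ∈ B, localSize r x y i ^ 2 :=
    (sum_filter_add_sum_filter_not _ _ _).symm
  have hex : ∀ i, ∃ s, (s = i ∨ s = i + 1) ∧ (i ∈ B → ∃ σ, 0 ≤ σ ∧ c * localSize r x y i ^ 2 ≤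
        σ * (lam * nbrSum r (fun t => |x t - y t|) s - 2 * r * C * (|x s - y s| + 2 * σ))) := by
    intro i
    by_cases hi : i ∈ B
    · obtain ⟨hiT, hi'⟩ := mem_filter.1 hi
      obtain ⟨s, hs, h⟩ := (hgain x y i (hcr i hiT)).resolve_left hi'
      exact ⟨s, hs, fun _ => h⟩
    · exact ⟨i, Or.inl rfl, fun h => absurd h hi⟩
  choose s hs hsB using hex
  have hBT : B ⊆ T := filter_subset _ _
  have hBs : IsSparse r i₀ i₁ B := ⟨fun i hi => hT.1 i (hBT hi),
    fun i hi j hj => hT.2 i (hBT hi) j (hBT hj)⟩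
  obtain ⟨X, Y, hXY, hE⟩ := exists_smoothing hf x y hs B hBs hsB
  have hout : ∀ t, t ∉ Icc i₀ i₁ → X t = x t ∧ Y t = y t := by
    intro t ht
    have := hXY t (fun i hi hti => ht (by
      have h1 := hBs.1 i hi
      have h2 := hs i
      simp only [mem_Icc]
      omega))
    simpa only [maxOn, minOn, if_neg ht] using this
  have h1 := hx i₀ i₁ X h01 fun t ht => (hout t ht).1
  have h2 := hy i₀ i₁ Y h01 fun t ht => (hout t ht).2
  have h3 := energyOn_exchange_le hf hr hC.le hl.le x y i₀ i₁ A (fun i hi => by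
    have := hT.1 i (mem_filter.1 hi).1
    simp only [mem_Ico]
    omega)
  have h4 : c * ∑ i ∈ A, localSize r x y i ^ 2 ≤ lam * ∑ i ∈ A, crossWeight x y i := by
    rw [mul_sum, mul_sum]
    exact sum_le_sum fun i hi => (mem_filter.1 hi).2
  rw [div_mul_eq_mul_div, div_le_iff₀ hC, hsplit]
  linarith

/-! ### Crossings and the comparison principle. -/

/-- A discrete intermediate value theorem. -/
theorem exists_crossesAt {x y : ℤ → ℝ} {p q : ℤ} (hp : y p < x p) (hq : x q ≤ y q) :
    ∃ i, min p q ≤ i ∧ i < max p q ∧ CrossesAt x y i ∧ (y i < x i ∨ y (i + 1) < x (i + 1)) := by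
  rcases lt_trichotomy p q with h | h | h
  · rw [min_eq_left h.le, max_eq_right h.le]
    obtain ⟨n, hn⟩ := Int.eq_ofNat_of_zero_le (sub_nonneg.2 h.le)
    obtain rfl : q = p + n := by omega
    clear hn h
    induction n with
    | zero => simp at hq; linarith
    | succ n ih =>
      rcases le_or_gt (x (p + n)) (y (p + n)) with h' | h'
      · obtain ⟨i, h1, h2, h3⟩ := ih h'
        exact ⟨i, h1, by push_cast; omega, h3⟩
      · refine ⟨p + n, by omega, by push_cast; omega, ?_, Or.inl h'⟩
        push_cast at hq
        rw [← add_assoc] at hq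
        exact mul_nonpos_of_nonneg_of_nonpos (by linarith) (by linarith)
  · subst h; linarith
  · rw [min_eq_right h.le, max_eq_left h.le]
    obtain ⟨n, hn⟩ := Int.eq_ofNat_of_zero_le (sub_nonneg.2 h.le)
    obtain rfl : q = p - n := by omega
    clear hn h
    induction n with
    | zero => simp at hq; linarith
    | succ n ih =>
      rcases le_or_gt (x (p - n)) (y (p - n)) with h' | h'
      · obtain ⟨i, h1, h2, h3⟩ := ih h'
        exact ⟨i, by push_cast; omega, h2, h3⟩
      · have e : p - ((n + 1 : ℕ) : ℤ) + 1 = p - n := by push_cast; omega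
        refine ⟨p - (n + 1 : ℕ), by omega, by push_cast; omega, ?_, Or.inr (by rwa [e])⟩
        unfold CrossesAt
        rw [e]
        exact mul_nonpos_of_nonpos_of_nonneg (by linarith) (by linarith)

/-- Comparison principle: if `x ≤ y` near the ends of a segment, then `x ≤ y` on the segment. -/
theorem IsPairMinimizer.le_of_le_ends {r : ℕ} {C lam : ℝ} {f : Fin r → ℝ → ℝ → ℝ}
    (hf : ∀ j, HasPairBounds C lam (f j)) {x y : ℤ → ℝ} (hx : IsPairMinimizer f x)
    (hy : IsPairMinimizer f y) (hr : 1 ≤ r) (hC : 0 < C) (hl : 0 < lam) {i₀ i₁ : ℤ}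
    (h₀ : ∀ t ∈ Icc (i₀ - r) (i₀ + r), x t ≤ y t) (h₁ : ∀ t ∈ Icc (i₁ - r) (i₁ + r), x t ≤ y t)
    {p : ℤ} (hp : p ∈ Icc i₀ i₁) : x p ≤ y p := by
  by_contra hlt
  push Not at hlt
  simp only [mem_Icc] at hp h₀ h₁
  have hp0 : i₀ + r < p := by
    by_contra h
    exact absurd (h₀ p (by omega)) (not_le.2 hlt)
  have hp1 : p < i₁ - r := by
    by_contra h
    exact absurd (h₁ p (by omega)) (not_le.2 hlt)
  obtain ⟨i, hi1, hi2, hi3, hi4⟩ := exists_crossesAt hlt (h₁ (i₁ - r) (by omega))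
  rw [min_eq_left hp1.le] at hi1
  rw [max_eq_right hp1.le] at hi2
  obtain ⟨c, hc, hb⟩ := exists_crossing_bound (r := r) hr hC hl
  -- The roles are exchanged, so that the end terms are excesses of `x` over `y`, which vanish by
  -- hypothesis.
  have := hb f hf y x hy hx i₀ i₁ {i} ⟨by simp; omega, by simp⟩
    (by simpa using hi3.symm) (by omega)
  rw [sum_singleton, windowSum_eq_zero (fun t ht => excess_eq_zero (h₀ t (mem_Icc.1 ht))),
    windowSum_eq_zero (fun t ht => excess_eq_zero (h₁ t (mem_Icc.1 ht)))] at this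
  have hV : 0 < localSize r y x i := by
    rcases hi4 with h | h
    · exact lt_of_lt_of_le (abs_pos.2 (by linarith)) (abs_le_localSize (t := i) _ _ (by omega)
        (by omega))
    · exact lt_of_lt_of_le (abs_pos.2 (by linarith)) (abs_le_localSize (t := i + 1) _ _ (by omega)
        (by omega))
  have : 0 < c * localSize r y x i ^ 2 := by positivity
  linarith

/-! ### From partial sums to exponential oscillation. -/

/-- A sequence of nonnegative reals which eventually dominates a fraction of its partial sums grows
exponentially along an arithmetic progression whose step depends only on the fraction. -/
theorem exists_exponential_growth {ε : ℝ} (hε : 0 < ε) :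
    ∃ q : ℕ, 1 ≤ q ∧ ∀ g : ℕ → ℝ, (∀ n, 0 ≤ g n) → 0 < g 0 →
      ∀ m₀ : ℕ, 1 ≤ m₀ → (∀ m, m₀ ≤ m → ε * ∑ n ∈ range m, g n ≤ g m) → ∀ R : ℝ,
      ∃ m₁, m₀ ≤ m₁ ∧ ∀ n : ℕ, R * 4 ^ n ≤ g (m₁ + q * n) := by
  -- The partial sums grow by `1 + ε` per step, hence by more than `4` in `q` steps; `4` because `g`
  -- will be a squared amplitude, which is to double.
  obtain ⟨q, hq⟩ := pow_unbounded_of_one_lt (4 : ℝ) (by linarith : 1 < 1 + ε)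
  have hq1 : 1 ≤ q := by
    by_contra h
    have : q = 0 := by omega
    subst this
    norm_num at hq
  refine ⟨q, hq1, fun g hg hg0 m₀ hm₀ h R => ?_⟩
  set G : ℕ → ℝ := fun m => ∑ n ∈ range m, g n with hG
  have hGpos : 0 < G m₀ :=
    lt_of_lt_of_le hg0 (single_le_sum (fun n _ => hg n) (mem_range.2 (by omega)))
  have hGpow : ∀ n, (1 + ε) ^ n * G m₀ ≤ G (m₀ + n) := by
    intro n
    induction n with
    | zero => simp
    | succ n ih =>
      have h1 := h (m₀ + n) (by omega)
      have h2 : G (m₀ + (n + 1)) = G (m₀ + n) + g (m₀ + n) := sum_range_succ _ _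
      rw [h2, pow_succ]
      have : (1 + ε) * ((1 + ε) ^ n * G m₀) ≤ (1 + ε) * G (m₀ + n) :=
        mul_le_mul_of_nonneg_left ih (by linarith)
      simp only [hG] at *
      linarith
  obtain ⟨N, hN⟩ := pow_unbounded_of_one_lt (R / (ε * G m₀)) (by linarith : 1 < 1 + ε)
  refine ⟨m₀ + N, by omega, fun n => ?_⟩
  have h1 := h (m₀ + (N + q * n)) (by omega)
  have h2 := hGpow (N + q * n)
  have h3 : R ≤ ε * G m₀ * (1 + ε) ^ N := by
    rw [div_lt_iff₀ (by positivity)] at hN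
    linarith
  have h4 : (4 : ℝ) ^ n ≤ (1 + ε) ^ (q * n) := by
    rw [pow_mul]
    exact pow_le_pow_left₀ (by norm_num) hq.le n
  calc R * 4 ^ n ≤ ε * G m₀ * (1 + ε) ^ N * 4 ^ n := mul_le_mul_of_nonneg_right h3 (by positivity)
    _ ≤ ε * G m₀ * (1 + ε) ^ N * (1 + ε) ^ (q * n) := mul_le_mul_of_nonneg_left h4 (by positivity)
    _ = ε * ((1 + ε) ^ (N + q * n) * G m₀) := by rw [pow_add]; ring
    _ ≤ ε * G (m₀ + (N + q * n)) := mul_le_mul_of_nonneg_left h2 hε.le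
    _ ≤ g (m₀ + N + q * n) := by rw [add_assoc]; exact h1

/-- The sequence `u` oscillates around zero with exponentially growing amplitude, in one direction
and with gaps at most `d`. -/
def HasGrowth (r d : ℕ) (u : ℤ → ℝ) : Prop :=
  ∃ k l : ℕ → ℤ, ((StrictMono k ∧ StrictMono l) ∨ (StrictAnti k ∧ StrictAnti l)) ∧
    (∀ n, |k (n + 1) - k n| ≤ (d : ℤ)) ∧ (∀ n, |l n - k n| ≤ (r : ℤ)) ∧
    ∀ n, 0 ≤ u (k n) ∧ u (l n) ≤ 0 ∧ (2 : ℝ) ^ n ≤ (u (k n) + 1) * (-u (l n) + 1)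

/-- Averaging over the `2 * r` sites gives one where the difference is at least `B` in size; a site
of the opposite weak sign is found at `i` or `i + 1`, and both are within distance `r` of that
block's sites. -/
theorem CrossesAt.exists_pair {r : ℕ} (hr : 1 ≤ r) {x y : ℤ → ℝ} {i : ℤ} (h : CrossesAt x y i)
    {B : ℝ} (hB : 2 * r * B ≤ localSize r x y i) :
    ∃ k l : ℤ, k ∈ Icc (i - r + 1) (i + r) ∧ l ∈ Icc (i - r + 1) (i + r) ∧ |l - k| ≤ (r : ℤ) ∧
      0 ≤ x k - y k ∧ x l - y l ≤ 0 ∧ B ≤ (x k - y k + 1) * (-(x l - y l) + 1) := by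
  obtain ⟨t, ht, htB⟩ : ∃ t ∈ Icc (i - r + 1) (i + r), B ≤ |x t - y t| := by
    refine exists_le_of_sum_le (f := fun _ => B) ⟨i, by simp; omega⟩ ?_
    rw [sum_const, Int.card_Icc, nsmul_eq_mul]
    have : (i + r + 1 - (i - r + 1)).toNat = 2 * r := by omega
    rw [this]
    push_cast
    exact hB
  have hsigns : ∃ a b : ℤ, (a = i ∨ a = i + 1) ∧ (b = i ∨ b = i + 1) ∧
      0 ≤ x a - y a ∧ x b - y b ≤ 0 := by
    unfold CrossesAt at h
    rcases le_total 0 (x i - y i) with h0 | h0 <;>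
      rcases le_total 0 (x (i + 1) - y (i + 1)) with h1 | h1
    · rcases mul_eq_zero.1 (le_antisymm h (mul_nonneg h0 h1)) with h2 | h2
      · exact ⟨i, i, Or.inl rfl, Or.inl rfl, h0, h2.le⟩
      · exact ⟨i + 1, i + 1, Or.inr rfl, Or.inr rfl, h1, h2.le⟩
    · exact ⟨i, i + 1, Or.inl rfl, Or.inr rfl, h0, h1⟩
    · exact ⟨i + 1, i, Or.inr rfl, Or.inl rfl, h1, h0⟩
    · rcases mul_eq_zero.1 (le_antisymm h (mul_nonneg_of_nonpos_of_nonpos h0 h1)) with h2 | h2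
      · exact ⟨i, i, Or.inl rfl, Or.inl rfl, h2.ge, h0⟩
      · exact ⟨i + 1, i + 1, Or.inr rfl, Or.inr rfl, h2.ge, h1⟩
  obtain ⟨a, b, ha, hb, hau, hbu⟩ := hsigns
  simp only [mem_Icc] at ht ⊢
  rcases le_total 0 (x t - y t) with h0 | h0
  · rw [abs_of_nonneg h0] at htB
    refine ⟨t, b, by omega, by omega, abs_le.2 ⟨by omega, by omega⟩, h0, hbu, ?_⟩
    nlinarith
  · rw [abs_of_nonpos h0] at htB
    refine ⟨a, t, by omega, by omega, abs_le.2 ⟨by omega, by omega⟩, hau, h0, ?_⟩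
    nlinarith

/-- The chosen sites lie at distance less than `2 * r` from centres that are `4 * r * q` apart,
hence strict monotonicity and the gap `4 * r * q + 4 * r`. -/
theorem hasGrowth_of_crossings {r q : ℕ} (hr : 1 ≤ r) (hq : 1 ≤ q) {x y : ℤ → ℝ} {e : ℤ}
    (he : e = 1 ∨ e = -1) (w₀ : ℤ) (h : ∀ n : ℕ, ∃ i, w₀ + e * (4 * r * (q * n)) - r ≤ i ∧
      i < w₀ + e * (4 * r * (q * n)) + r ∧ CrossesAt x y i ∧
      (2 * r : ℝ) ^ 2 * 4 ^ n ≤ localSize r x y i ^ 2) :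
    HasGrowth r (4 * r * q + 4 * r) (fun i => x i - y i) := by
  have hpair : ∀ n : ℕ, ∃ k l : ℤ, (w₀ + e * (4 * r * (q * n)) - 2 * r < k ∧
      k < w₀ + e * (4 * r * (q * n)) + 2 * r) ∧ (w₀ + e * (4 * r * (q * n)) - 2 * r < l ∧
      l < w₀ + e * (4 * r * (q * n)) + 2 * r) ∧ |l - k| ≤ (r : ℤ) ∧
      0 ≤ x k - y k ∧ x l - y l ≤ 0 ∧ 2 ^ n ≤ (x k - y k + 1) * (-(x l - y l) + 1) := by
    intro n
    obtain ⟨i, h1, h2, h3, h4⟩ := h n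
    have h5 : 2 * r * (2 : ℝ) ^ n ≤ localSize r x y i := by
      refine le_of_sq_le_sq ?_ (localSize_nonneg r x y i)
      calc (2 * r * (2 : ℝ) ^ n) ^ 2 = (2 * r : ℝ) ^ 2 * 4 ^ n := by
            rw [mul_pow, ← pow_mul, mul_comm n 2, pow_mul]; norm_num
        _ ≤ _ := h4
    obtain ⟨k, l, hk, hl, hrest⟩ := h3.exists_pair hr h5
    simp only [mem_Icc] at hk hl
    exact ⟨k, l, by omega, by omega, hrest⟩
  choose k l hk hl hrest using hpair
  have hstep : (4 * r : ℤ) ≤ 4 * r * q := by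
    have h1 : 4 * r * 1 ≤ 4 * r * q := Nat.mul_le_mul_left _ hq
    have h2 : ((4 * r * 1 : ℕ) : ℤ) ≤ ((4 * r * q : ℕ) : ℤ) := by exact_mod_cast h1
    push_cast at h2
    linarith
  have hw : ∀ n : ℕ, (4 * r * (q * ((n + 1 : ℕ) : ℤ)) : ℤ) = 4 * r * (q * n) + 4 * r * q := by
    intro n; push_cast; ring
  refine ⟨k, l, ?_, fun n => ?_, fun n => (hrest n).1, fun n => (hrest n).2⟩
  · rcases he with rfl | rfl
    · refine Or.inl ⟨strictMono_nat_of_lt_succ fun n => ?_, strictMono_nat_of_lt_succ fun n => ?_⟩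
      · have h1 := hk n
        have h2 := hk (n + 1)
        rw [hw] at h2
        linarith
      · have h1 := hl n
        have h2 := hl (n + 1)
        rw [hw] at h2
        linarith
    · refine Or.inr ⟨strictAnti_nat_of_succ_lt fun n => ?_, strictAnti_nat_of_succ_lt fun n => ?_⟩
      · have h1 := hk n
        have h2 := hk (n + 1)
        rw [hw] at h2
        linarith
      · have h1 := hl n
        have h2 := hl (n + 1)
        rw [hw] at h2
        linarith
  · have h1 := hk n
    have h2 := hk (n + 1)
    rw [hw] at h2
    push_cast
    rw [abs_le]
    rcases he with rfl | rfl <;> constructor <;> linarith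

/-! ### The dichotomy for two unordered minimizers. -/

/-- `x ≤ y` holds eventually on the right if it holds on windows arbitrarily far to the right. -/
theorem IsPairMinimizer.eventually_le_right {r : ℕ} {C lam : ℝ} {f : Fin r → ℝ → ℝ → ℝ}
    (hf : ∀ j, HasPairBounds C lam (f j)) {x y : ℤ → ℝ} (hx : IsPairMinimizer f x)
    (hy : IsPairMinimizer f y) (hr : 1 ≤ r) (hC : 0 < C) (hl : 0 < lam)
    (h : ∀ K : ℤ, ∃ w, K ≤ w ∧ ∀ t ∈ Icc (w - r) (w + r), x t ≤ y t) :
    ∃ N : ℤ, ∀ i, N ≤ i → x i ≤ y i := by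
  obtain ⟨N, -, hN⟩ := h 0
  refine ⟨N, fun i hi => ?_⟩
  obtain ⟨w, hw, hw'⟩ := h i
  exact hx.le_of_le_ends hf hy hr hC hl hN hw' (mem_Icc.2 ⟨hi, hw⟩)

theorem IsPairMinimizer.eventually_le_left {r : ℕ} {C lam : ℝ} {f : Fin r → ℝ → ℝ → ℝ}
    (hf : ∀ j, HasPairBounds C lam (f j)) {x y : ℤ → ℝ} (hx : IsPairMinimizer f x)
    (hy : IsPairMinimizer f y) (hr : 1 ≤ r) (hC : 0 < C) (hl : 0 < lam)
    (h : ∀ K : ℤ, ∃ w, w ≤ K ∧ ∀ t ∈ Icc (w - r) (w + r), x t ≤ y t) :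
    ∃ N : ℤ, ∀ i, i ≤ N → x i ≤ y i := by
  obtain ⟨N, -, hN⟩ := h 0
  refine ⟨N, fun i hi => ?_⟩
  obtain ⟨w, hw, hw'⟩ := h i
  exact hx.le_of_le_ends hf hy hr hC hl hw' hN (mem_Icc.2 ⟨hw, hi⟩)

/-- `x` is eventually below `y` on the left and eventually above `y` on the right. -/
def CrossesUp (x y : ℤ → ℝ) : Prop :=
  (∃ N : ℤ, ∀ i, N ≤ i → y i ≤ x i) ∧ ∃ N : ℤ, ∀ i, i ≤ N → x i ≤ y i

/-- Two windows, one on each side of a crossing, cannot both have a small negative part. The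
abstract form: `ν` and `π` are the squared window sums and `g` the squared sizes at crossings. -/
theorem not_both_small {c : ℝ} (hc : 0 < c) {g ν : ℤ → ℝ} (hg : ∀ n, 0 ≤ g n) (hg0 : 0 < g 0)
    (hν : ∀ a b : ℤ, a < b → c * ∑ n ∈ Ioo a b, g n ≤ ν a + ν b) {m m' : ℕ} (hm : 1 ≤ m)
    (hm' : 1 ≤ m') (h : ν m ≤ c / 4 * ∑ n ∈ range m, g n)
    (h' : ν (-m') ≤ c / 4 * ∑ n ∈ range m', g (-n)) : False := by
  have h1 := hν (-m') m (by omega)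
  have h2 : ∑ n ∈ range m, g n ≤ ∑ n ∈ Ioo (-m' : ℤ) m, g n := by
    rw [← sum_image (f := g) (s := range m) (g := fun n : ℕ => (n : ℤ)) (fun a _ b _ hab => by
      simpa using hab)]
    refine sum_le_sum_of_subset_of_nonneg (fun t ht => ?_) fun n _ _ => hg n
    simp only [mem_image, mem_range, mem_Ioo] at ht ⊢
    obtain ⟨a, ha, rfl⟩ := ht
    omega
  have h3 : ∑ n ∈ range m', g (-n) ≤ ∑ n ∈ Ioo (-m' : ℤ) m, g n := by
    rw [← sum_image (f := g) (s := range m') (g := fun n : ℕ => (-n : ℤ)) (fun a _ b _ hab => by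
      simpa using hab)]
    refine sum_le_sum_of_subset_of_nonneg (fun t ht => ?_) fun n _ _ => hg n
    simp only [mem_image, mem_range, mem_Ioo] at ht ⊢
    obtain ⟨a, ha, rfl⟩ := ht
    omega
  have h4 : g 0 ≤ ∑ n ∈ Ioo (-m' : ℤ) m, g n :=
    single_le_sum (fun n _ => hg n) (mem_Ioo.2 ⟨by omega, by omega⟩)
  have h5 : 0 < c * ∑ n ∈ Ioo (-m' : ℤ) m, g n := mul_pos hc (by linarith)
  have h6 := mul_le_mul_of_nonneg_left h2 (by positivity : 0 ≤ c / 4)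
  have h7 := mul_le_mul_of_nonneg_left h3 (by positivity : 0 ≤ c / 4)
  linarith

/-- Two global minimizers which are not ordered either oscillate around each other with
exponentially growing amplitude, or cross essentially once. -/
theorem exists_growth_or_crossesUp {r : ℕ} {C lam : ℝ} (hr : 1 ≤ r) (hC : 0 < C) (hl : 0 < lam) :
    ∃ d : ℕ, ∀ f : Fin r → ℝ → ℝ → ℝ, (∀ j, HasPairBounds C lam (f j)) → ∀ x y : ℤ → ℝ,
      IsPairMinimizer f x → IsPairMinimizer f y → ∀ p q : ℤ, y p < x p → x q < y q →
      HasGrowth r d (fun i => x i - y i) ∨ CrossesUp x y ∨ CrossesUp y x := by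
  classical
  obtain ⟨c, hc, hbound⟩ := exists_crossing_bound (r := r) hr hC hl
  set C₃ : ℝ := 2 * growthFactor r C lam ^ (r + 1) with hC₃
  have hgf := one_le_growthFactor (r := r) hC.le hl
  have hC₃0 : 0 < C₃ := by positivity
  -- Chosen so that `C₃ ^ 2 * ε = c / 4`, the smallness threshold of `not_both_small`.
  set ε : ℝ := c / (4 * C₃ ^ 2) with hε
  have hε0 : 0 < ε := by positivity
  obtain ⟨Q, hQ1, hQ⟩ := exists_exponential_growth hε0
  refine ⟨4 * r * Q + 4 * r, fun f hf x y hx hy p q hp hq => ?_⟩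
  obtain ⟨w₀, -, -, hw₀, hne⟩ := exists_crossesAt hp hq.le
  have hV₀ : 0 < localSize r x y w₀ := by
    rcases hne with h | h
    · exact lt_of_lt_of_le (abs_pos.2 (by linarith)) (abs_le_localSize (t := w₀) _ _ (by omega)
        (by omega))
    · exact lt_of_lt_of_le (abs_pos.2 (by linarith)) (abs_le_localSize (t := w₀ + 1) _ _ (by omega)
        (by omega))
  -- The spacing `4 * r` makes crossings taken from distinct windows of radius `r` sparse.
  set w : ℤ → ℤ := fun m => w₀ + 4 * r * m with hw
  have hwlt : ∀ {m n : ℤ}, m < n → w m + 4 * r ≤ w n := by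
    intro m n hmn
    simp only [hw]
    nlinarith
  set P : ℤ → Prop := fun m => ∃ i, w m - r ≤ i ∧ i < w m + r ∧ CrossesAt x y i with hP
  have hidx : ∀ m, ∃ i, w m - r ≤ i ∧ i < w m + r ∧ (P m → CrossesAt x y i) := by
    intro m
    by_cases h : P m
    · obtain ⟨i, h1, h2, h3⟩ := h
      exact ⟨i, h1, h2, fun _ => h3⟩
    · exact ⟨w m, by omega, by omega, fun h' => absurd h' h⟩
  choose idx hi1 hi2 hi3 using hidx
  set g : ℤ → ℝ := fun m => if P m then localSize r x y (idx m) ^ 2 else 0 with hg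
  have hgnn : ∀ n, 0 ≤ g n := fun n => by
    simp only [hg]; split_ifs <;> positivity
  have hP0 : P 0 := ⟨w₀, by simp only [hw]; omega, by simp only [hw]; omega, hw₀⟩
  have hg0 : 0 < g 0 := by
    simp only [hg, if_pos hP0]
    have h1 := hx.localSize_le_pow hf hy hr hC.le hl r (idx 0) w₀ (by
      have h1 := hi1 0
      have h2 := hi2 0
      simp only [hw] at h1 h2
      rw [abs_le]
      omega)
    have h2 : 0 < growthFactor r C lam ^ r := by positivity
    have : 0 < localSize r x y (idx 0) := pos_of_mul_pos_right (hV₀.trans_le h1) h2.le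
    positivity
  have hsep : ∀ {m n : ℤ}, m < n → idx m + r + 2 ≤ idx n := by
    intro m n hmn
    have h1 := hwlt hmn
    have h2 := hi2 m
    have h3 := hi1 n
    omega
  have hinj : Function.Injective idx := fun a b hab => by
    rcases lt_trichotomy a b with h | h | h
    · have := hsep h; omega
    · exact h
    · have := hsep h; omega
  have hT : ∀ a b : ℤ, IsSparse r (w a) (w b) (((Ioo a b).filter P).image idx) := by
    intro a b
    constructor
    · intro i hi
      simp only [mem_image, mem_filter, mem_Ioo] at hi
      obtain ⟨n, ⟨⟨h1, h2⟩, -⟩, rfl⟩ := hi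
      have h3 := hwlt h1
      have h4 := hwlt h2
      have h5 := hi1 n
      have h6 := hi2 n
      omega
    · intro i hi j hj hij
      simp only [mem_image, mem_filter, mem_Ioo] at hi hj
      obtain ⟨n, -, rfl⟩ := hi
      obtain ⟨m, -, rfl⟩ := hj
      refine hsep ?_
      by_contra h
      rcases (not_lt.1 h).eq_or_lt with h | h
      · subst h; omega
      · have := hsep h; omega
  have hTc : ∀ a b : ℤ, ∀ i ∈ ((Ioo a b).filter P).image idx, CrossesAt x y i := by
    intro a b i hi
    simp only [mem_image, mem_filter, mem_Ioo] at hi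
    obtain ⟨n, ⟨-, h⟩, rfl⟩ := hi
    exact hi3 n h
  have hTs : ∀ a b : ℤ, ∑ i ∈ ((Ioo a b).filter P).image idx, localSize r x y i ^ 2 =
      ∑ n ∈ Ioo a b, g n := by
    intro a b
    rw [sum_image fun m _ n _ h => hinj h, sum_filter]
  set ν : ℤ → ℝ := fun m => windowSum r (excess y x) (w m) ^ 2 with hν
  set π : ℤ → ℝ := fun m => windowSum r (excess x y) (w m) ^ 2 with hπ
  have hwle : ∀ {a b : ℤ}, a < b → w a ≤ w b := fun hab => by have := hwlt hab; omega
  have KN : ∀ a b : ℤ, a < b → c * ∑ n ∈ Ioo a b, g n ≤ ν a + ν b := by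
    intro a b hab
    rw [← hTs]
    exact hbound f hf x y hx hy _ _ _ (hT a b) (hTc a b) (hwle hab)
  have KP : ∀ a b : ℤ, a < b → c * ∑ n ∈ Ioo a b, g n ≤ π a + π b := by
    intro a b hab
    rw [← hTs]
    simp only [localSize_comm r x y]
    exact hbound f hf y x hy hx _ _ _ (hT a b) (fun i hi => (hTc a b i hi).symm) (hwle hab)
  have hnear : ∀ m, |w m - idx m| ≤ (r : ℤ) := fun m => by
    have h1 := hi1 m
    have h2 := hi2 m
    rw [abs_le]
    omega
  have hνg : ∀ m, P m → ν m ≤ C₃ ^ 2 * g m := fun m hm => by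
    have := hy.windowSum_le hf hx hr hC.le hl (hnear m)
    rw [localSize_comm] at this
    simp only [hg, if_pos hm, hν]
    rw [← mul_pow]
    exact pow_le_pow_left₀ (windowSum_nonneg r (excess_nonneg y x) _) this 2
  have hπg : ∀ m, P m → π m ≤ C₃ ^ 2 * g m := fun m hm => by
    have := hx.windowSum_le hf hy hr hC.le hl (hnear m)
    simp only [hg, if_pos hm, hπ]
    rw [← mul_pow]
    exact pow_le_pow_left₀ (windowSum_nonneg r (excess_nonneg x y) _) this 2
  -- Without a crossing in the window the intermediate value theorem forces a constant sign, so one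
  -- of `ν m` and `π m` vanishes.
  have hsign : ∀ m, ¬ P m → (∀ t ∈ Icc (w m - r) (w m + r), y t ≤ x t) ∨
      (∀ t ∈ Icc (w m - r) (w m + r), x t ≤ y t) := by
    intro m hm
    by_contra h
    push Not at h
    obtain ⟨⟨a, ha, ha'⟩, ⟨b, hb, hb'⟩⟩ := h
    obtain ⟨i, h1, h2, h3, -⟩ := exists_crossesAt hb' ha'.le
    simp only [mem_Icc] at ha hb
    exact hm ⟨i, by omega, by omega, h3⟩
  have hν0 : ∀ m, (∀ t ∈ Icc (w m - r) (w m + r), y t ≤ x t) → ν m = 0 := fun m h => by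
    simp only [hν]
    rw [windowSum_eq_zero fun t ht => excess_eq_zero (h t ht)]
    norm_num
  have hπ0 : ∀ m, (∀ t ∈ Icc (w m - r) (w m + r), x t ≤ y t) → π m = 0 := fun m h => by
    simp only [hπ]
    rw [windowSum_eq_zero fun t ht => excess_eq_zero (h t ht)]
    norm_num
  have hmain : ∀ e : ℤ, (e = 1 ∨ e = -1) → ∀ m₀ : ℕ, 1 ≤ m₀ →
      (∀ m : ℕ, m₀ ≤ m → ε * ∑ n ∈ range m, g (e * n) ≤ g (e * m)) →
      HasGrowth r (4 * r * Q + 4 * r) (fun i => x i - y i) := by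
    intro e he m₀ hm₀ hgrow
    obtain ⟨m₁, -, hm₁⟩ := hQ (fun n => g (e * n)) (fun n => hgnn _) (by simpa using hg0)
      m₀ hm₀ hgrow ((2 * r) ^ 2)
    refine hasGrowth_of_crossings hr hQ1 he (w₀ + e * (4 * r * m₁)) fun n => ?_
    have h1 := hm₁ n
    have e1 : w (e * ((m₁ + Q * n : ℕ) : ℤ)) =
        w₀ + e * (4 * r * m₁) + e * (4 * r * (Q * n)) := by
      simp only [hw]; push_cast; ring
    -- The lower bound is positive, whereas `g` vanishes at windows without a crossing.
    have hPm : P (e * ((m₁ + Q * n : ℕ) : ℤ)) := by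
      by_contra h
      simp only [hg, if_neg h] at h1
      have : (0 : ℝ) < (2 * r) ^ 2 * 4 ^ n := by
        have : (0 : ℝ) < r := by exact_mod_cast hr
        positivity
      linarith
    simp only [hg, if_pos hPm] at h1
    rw [← e1]
    exact ⟨_, hi1 _, hi2 _, hi3 _ hPm, h1⟩
  by_cases hR : ∃ m₀ : ℕ, 1 ≤ m₀ ∧
      ∀ m : ℕ, m₀ ≤ m → ε * ∑ n ∈ range m, g (1 * n) ≤ g (1 * m)
  · obtain ⟨m₀, h1, h2⟩ := hR
    exact Or.inl (hmain 1 (Or.inl rfl) m₀ h1 h2)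
  by_cases hL : ∃ m₀ : ℕ, 1 ≤ m₀ ∧
      ∀ m : ℕ, m₀ ≤ m → ε * ∑ n ∈ range m, g (-1 * n) ≤ g (-1 * m)
  · obtain ⟨m₀, h1, h2⟩ := hL
    exact Or.inl (hmain (-1) (Or.inr rfl) m₀ h1 h2)
  right
  push Not at hR hL
  simp only [one_mul, neg_mul] at hR hL
  -- smallness at windows where the growth fails
  have hεC : C₃ ^ 2 * ε = c / 4 := by rw [hε]; field_simp
  have hsm : ∀ (m : ℤ) (G : ℝ), g m < ε * G → P m → ν m ≤ c / 4 * G ∧ π m ≤ c / 4 * G := by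
    intro m G hG hm
    have h1 : C₃ ^ 2 * g m ≤ c / 4 * G := by
      rw [← hεC, mul_assoc]
      exact mul_le_mul_of_nonneg_left hG.le (by positivity)
    exact ⟨(hνg m hm).trans h1, (hπg m hm).trans h1⟩
  have hSR : ∀ m : ℕ, 0 ≤ c / 4 * ∑ n ∈ range m, g n := fun m =>
    mul_nonneg (by positivity) (sum_nonneg fun _ _ => hgnn _)
  have hSL : ∀ m : ℕ, 0 ≤ c / 4 * ∑ n ∈ range m, g (-n) := fun m =>
    mul_nonneg (by positivity) (sum_nonneg fun _ _ => hgnn _)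
  -- a window on the right and a window on the left are of opposite type
  have hopp : ∀ m m' : ℕ, 1 ≤ m → 1 ≤ m' → g m < ε * ∑ n ∈ range m, g n →
      g (-m') < ε * ∑ n ∈ range m', g (-n) →
      ((∀ t ∈ Icc (w m - r) (w m + r), y t ≤ x t) ∧
        (∀ t ∈ Icc (w (-m') - r) (w (-m') + r), x t ≤ y t)) ∨
      ((∀ t ∈ Icc (w m - r) (w m + r), x t ≤ y t) ∧
        (∀ t ∈ Icc (w (-m') - r) (w (-m') + r), y t ≤ x t)) := by
    intro m m' hm hm' hgm hgm'
    -- Smallness of `ν` at both windows, or of `π` at both, is excluded. A crossing window would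
    -- have both small, while any window has at least one small, so both windows have constant sign
    -- and the signs differ.
    have hN := fun a b => not_both_small hc hgnn hg0 KN hm hm' a b
    have hPi := fun a b => not_both_small hc hgnn hg0 KP hm hm' a b
    by_cases h : P m
    · obtain ⟨h1, h2⟩ := hsm m _ hgm h
      by_cases h' : P (-m')
      · exact (hN h1 (hsm _ _ hgm' h').1).elim
      · rcases hsign _ h' with h' | h'
        · exact (hN h1 ((hν0 _ h').trans_le (hSL m'))).elim
        · exact (hPi h2 ((hπ0 _ h').trans_le (hSL m'))).elim
    · by_cases h' : P (-m')
      · obtain ⟨h1, h2⟩ := hsm _ _ hgm' h'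
        rcases hsign _ h with h | h
        · exact (hN ((hν0 _ h).trans_le (hSR m)) h1).elim
        · exact (hPi ((hπ0 _ h).trans_le (hSR m)) h2).elim
      · rcases hsign _ h with h | h <;> rcases hsign _ h' with h' | h'
        · exact (hN ((hν0 _ h).trans_le (hSR m)) ((hν0 _ h').trans_le (hSL m'))).elim
        · exact Or.inl ⟨h, h'⟩
        · exact Or.inr ⟨h, h'⟩
        · exact (hPi ((hπ0 _ h).trans_le (hSR m)) ((hπ0 _ h').trans_le (hSL m'))).elim
  have hfar : ∀ K : ℤ, ∃ m₀ : ℕ, 1 ≤ m₀ ∧ ∀ m : ℕ, m₀ ≤ m → K ≤ w m ∧ w (-m) ≤ -K := by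
    intro K
    refine ⟨(|K| + |w₀| + 1).toNat, by have := abs_nonneg K; have := abs_nonneg w₀; omega, ?_⟩
    intro m hm
    have h1 : |K| + |w₀| + 1 ≤ (m : ℤ) := by omega
    have h2 : (m : ℤ) ≤ 4 * r * m := by nlinarith
    have h3 := neg_abs_le w₀
    have h4 := le_abs_self w₀
    have h5 := le_abs_self K
    simp only [hw]
    constructor <;> linarith
  -- the types cannot change
  have hsame : ∀ m m' : ℕ, 1 ≤ m → 1 ≤ m' →
      ¬ ((∀ t ∈ Icc (w m - r) (w m + r), y t ≤ x t) ∧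
        (∀ t ∈ Icc (w (-m') - r) (w (-m') + r), y t ≤ x t)) ∧
      ¬ ((∀ t ∈ Icc (w m - r) (w m + r), x t ≤ y t) ∧
        (∀ t ∈ Icc (w (-m') - r) (w (-m') + r), x t ≤ y t)) := by
    intro m m' hm hm'
    exact ⟨fun h => not_both_small hc hgnn hg0 KN hm hm' ((hν0 _ h.1).trans_le (hSR m))
        ((hν0 _ h.2).trans_le (hSL m')),
      fun h => not_both_small hc hgnn hg0 KP hm hm' ((hπ0 _ h.1).trans_le (hSR m))
        ((hπ0 _ h.2).trans_le (hSL m'))⟩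
  -- One window on each side where the growth condition fails fixes the orientation; by `hsame` all
  -- other such windows, arbitrarily far out, have the same orientation.
  obtain ⟨a, ha1, ha⟩ := hR 1 le_rfl
  obtain ⟨b, hb1, hb⟩ := hL 1 le_rfl
  rcases hopp a b ha1 hb1 ha hb with ⟨h1, h2⟩ | ⟨h1, h2⟩
  · left
    refine ⟨hy.eventually_le_right hf hx hr hC hl fun K => ?_,
      hx.eventually_le_left hf hy hr hC hl fun K => ?_⟩
    · obtain ⟨m₀, hm₀, hK⟩ := hfar K
      obtain ⟨m, hm, hgm⟩ := hR m₀ hm₀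
      refine ⟨w m, (hK m hm).1, ?_⟩
      rcases hopp m b (hm₀.trans hm) hb1 hgm hb with h | h
      · exact h.1
      · exact ((hsame m b (hm₀.trans hm) hb1).2 ⟨h.1, h2⟩).elim
    · obtain ⟨m₀, hm₀, hK⟩ := hfar (-K)
      obtain ⟨m, hm, hgm⟩ := hL m₀ hm₀
      refine ⟨w (-m), by have := (hK m hm).2; omega, ?_⟩
      rcases hopp a m ha1 (hm₀.trans hm) ha hgm with h | h
      · exact h.2
      · exact ((hsame a m ha1 (hm₀.trans hm)).1 ⟨h1, h.2⟩).elim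
  · right
    refine ⟨hx.eventually_le_right hf hy hr hC hl fun K => ?_,
      hy.eventually_le_left hf hx hr hC hl fun K => ?_⟩
    · obtain ⟨m₀, hm₀, hK⟩ := hfar K
      obtain ⟨m, hm, hgm⟩ := hR m₀ hm₀
      refine ⟨w m, (hK m hm).1, ?_⟩
      rcases hopp m b (hm₀.trans hm) hb1 hgm hb with h | h
      · exact ((hsame m b (hm₀.trans hm) hb1).1 ⟨h.1, h2⟩).elim
      · exact h.1
    · obtain ⟨m₀, hm₀, hK⟩ := hfar (-K)
      obtain ⟨m, hm, hgm⟩ := hL m₀ hm₀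
      refine ⟨w (-m), by have := (hK m hm).2; omega, ?_⟩
      rcases hopp a m ha1 (hm₀.trans hm) ha hgm with h | h
      · exact ((hsame a m ha1 (hm₀.trans hm)).2 ⟨h1, h.2⟩).elim
      · exact h.2

/-! ### Translation invariance. -/

theorem IsPairInteraction.add_int {C lam : ℝ} {f : ℝ → ℝ → ℝ} (hf : IsPairInteraction C lam f)
    (ν μ : ℝ) (n : ℤ) : f (ν + n) (μ + n) = f ν μ := by
  induction n using Int.induction_on with
  | zero => simp
  | succ n ih =>
    push_cast at ih ⊢
    rw [← add_assoc, ← add_assoc, hf.periodic, ih]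
  | pred n ih =>
    push_cast at ih ⊢
    rw [← ih, ← hf.periodic (ν + _) (μ + _)]
    congr 1 <;> ring

theorem pairEnergy_shiftSeq {r : ℕ} {C lam : ℝ} {f : Fin r → ℝ → ℝ → ℝ}
    (hf : ∀ j, IsPairInteraction C lam (f j)) (k l i : ℤ) (x : ℤ → ℝ) :
    pairEnergy f i (shiftSeq k l x) = pairEnergy f (i - k) x := by
  refine sum_congr rfl fun j _ => ?_
  simp only [shiftSeq]
  rw [(hf j).add_int]
  congr 2
  ring

theorem pairEnergy_congr {r : ℕ} {f : Fin r → ℝ → ℝ → ℝ} {i : ℤ} {x y : ℤ → ℝ}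
    (h : ∀ t, i ≤ t → t ≤ i + r → x t = y t) : pairEnergy f i x = pairEnergy f i y := by
  refine sum_congr rfl fun j _ => ?_
  have := j.2
  rw [h i le_rfl (by omega), h (i + ((j : ℕ) + 1)) (by omega) (by omega)]

theorem energyOn_shiftSeq {r : ℕ} {C lam : ℝ} {f : Fin r → ℝ → ℝ → ℝ}
    (hf : ∀ j, IsPairInteraction C lam (f j)) (k l a b : ℤ) (x : ℤ → ℝ) :
    energyOn f a b (shiftSeq k l x) = energyOn f (a - k) (b - k) x := by
  refine sum_bij' (fun i _ => i - k) (fun i _ => i + k) ?_ ?_ ?_ ?_ ?_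
  · intro i hi; simp only [mem_Icc] at hi ⊢; omega
  · intro i hi; simp only [mem_Icc] at hi ⊢; omega
  · intro i _; ring
  · intro i _; ring
  · intro i _; exact pairEnergy_shiftSeq hf k l i x

theorem IsPairMinimizer.translate {r : ℕ} {C lam : ℝ} {f : Fin r → ℝ → ℝ → ℝ}
    (hf : ∀ j, IsPairInteraction C lam (f j)) {x : ℤ → ℝ} (hx : IsPairMinimizer f x) (k l : ℤ) :
    IsPairMinimizer f (shiftSeq k l x) := by
  intro i₀ i₁ y h01 hy
  have hy' : y = shiftSeq k l (shiftSeq (-k) (-l) y) := by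
    funext i
    simp [shiftSeq]
  rw [hy', energyOn_shiftSeq hf, energyOn_shiftSeq hf, sub_right_comm]
  refine hx (i₀ - k) (i₁ - k) _ (by omega) fun i hi => ?_
  have := hy (i + k) (by simp only [mem_Icc] at hi ⊢; omega)
  simp only [shiftSeq, sub_neg_eq_add, this]
  push_cast
  rw [add_sub_cancel_right]
  ring

/-! ### Periodic minimizers are global minimizers. -/

/-- Sequences which are invariant under the translation by `(q, p)`. -/
def IsQuasiPeriodic (q p : ℤ) (z : ℤ → ℝ) : Prop := ∀ i, z (i + q) = z i + p

theorem IsQuasiPeriodic.add_mul {q p : ℤ} {z : ℤ → ℝ} (hz : IsQuasiPeriodic q p z) (n i : ℤ) :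
    z (i + n * q) = z i + n * p := by
  induction n using Int.induction_on with
  | zero => simp
  | succ n ih =>
    have := hz (i + n * q)
    rw [ih] at this
    rw [show i + ((n : ℤ) + 1) * q = i + n * q + q by ring, this]
    push_cast
    ring
  | pred n ih =>
    have := hz (i + (-n - 1) * q)
    rw [show i + (-(n : ℤ) - 1) * q + q = i + -n * q by ring, ih] at this
    push_cast at this ⊢
    linarith

theorem IsQuasiPeriodic.shiftSeq_eq {q p : ℤ} {z : ℤ → ℝ} (hz : IsQuasiPeriodic q p z) (n : ℤ) :
    shiftSeq (n * q) (n * p) z = z := by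
  funext i
  have := hz.add_mul n (i - n * q)
  rw [sub_add_cancel] at this
  rw [shiftSeq, this]
  push_cast
  ring

/-- The rearrangement inequality for submodular functions. -/
theorem sum_sort_le {n : ℕ} {φ : ℝ → ℝ → ℝ}
    (hφ : ∀ a a' b b', a ≤ a' → b ≤ b' → φ a b + φ a' b' ≤ φ a b' + φ a' b) (A B : Fin n → ℝ) :
    ∑ j, φ ((A ∘ Tuple.sort A) j) ((B ∘ Tuple.sort B) j) ≤ ∑ j, φ (A j) (B j) := by
  have h1 : ∑ j, φ (A j) (B j) = ∑ j, φ ((A ∘ Tuple.sort A) j) ((B ∘ Tuple.sort A) j) :=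
    (Equiv.sum_comp (Tuple.sort A) fun j => φ (A j) (B j)).symm
  rw [h1]
  have hA := Tuple.monotone_sort A
  rw [← Tuple.comp_perm_comp_sort_eq_comp_sort (f := B) (σ := Tuple.sort A)]
  set A' := A ∘ Tuple.sort A
  set B' := B ∘ Tuple.sort A
  -- After a common permutation `A'` is increasing; each bubble-sort swap corrects one inversion of
  -- the other tuple, and submodularity says that this does not raise the sum.
  refine Tuple.bubble_sort_induction (f := B')
    (P := fun g => ∑ j, φ (A' j) (g j) ≤ ∑ j, φ (A' j) (B' j)) le_rfl ?_
  intro g i j hij hg hP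
  refine le_trans ?_ hP
  have hne : i ≠ j := hij.ne
  rw [← add_sum_erase univ _ (mem_univ i), ← add_sum_erase univ (fun j => φ (A' j) (g j))
    (mem_univ i), ← add_sum_erase _ _ (mem_erase.2 ⟨hne.symm, mem_univ j⟩),
    ← add_sum_erase _ (fun j => φ (A' j) (g j)) (mem_erase.2 ⟨hne.symm, mem_univ j⟩)]
  have h2 : ∑ x ∈ (univ.erase i).erase j, φ (A' x) ((g ∘ Equiv.swap i j) x) =
      ∑ x ∈ (univ.erase i).erase j, φ (A' x) (g x) := by
    refine sum_congr rfl fun t ht => ?_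
    simp only [mem_erase] at ht
    rw [Function.comp_apply, Equiv.swap_apply_of_ne_of_ne ht.2.1 ht.1]
  rw [h2]
  simp only [Function.comp_apply, Equiv.swap_apply_left, Equiv.swap_apply_right]
  have := hφ _ _ _ _ (hA hij.le) hg.le
  linarith

theorem sort_comp_add_const {n : ℕ} (A : Fin n → ℝ) (c : ℝ) (m : Fin n) :
    ((fun j => A j + c) ∘ Tuple.sort (fun j => A j + c)) m = (A ∘ Tuple.sort A) m + c := by
  have h : (fun j => A j + c) ∘ Tuple.sort A = (fun j => A j + c) ∘ Tuple.sort (fun j => A j + c) :=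
    Tuple.comp_sort_eq_comp_iff_monotone.2 fun i j hij =>
      add_le_add_left (Tuple.monotone_sort A hij) c
  rw [← h]
  rfl

/-- Sorting the translates of an `(n q, n p)`-periodic sequence yields `(q, p)`-periodic ones, so
the minimal energy per period does not decrease when passing to multiples of the period. -/
theorem sum_translates_ge {r : ℕ} {C lam : ℝ} {f : Fin r → ℝ → ℝ → ℝ}
    (hf : ∀ j, IsPairInteraction C lam (f j)) (hl : 0 ≤ lam) {q p : ℤ} {E₀ : ℝ}
    (hE : ∀ z, IsQuasiPeriodic q p z → E₀ ≤ ∑ i ∈ Ico 0 q, pairEnergy f i z) (n : ℕ) (s : ℤ)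
    {ζ : ℤ → ℝ} (hζ : IsQuasiPeriodic ((n + 1) * q) ((n + 1) * p) ζ) :
    (n + 1) * E₀ ≤ ∑ j : Fin (n + 1), ∑ i ∈ Ico 0 q, pairEnergy f (i + (s - (j : ℕ)) * q) ζ := by
  set A : ℤ → Fin (n + 1) → ℝ := fun i j =>
    shiftSeq (((j : ℕ) - s) * q) (((j : ℕ) - s) * p) ζ i with hA
  set y : Fin (n + 1) → ℤ → ℝ := fun m i => (A i ∘ Tuple.sort (A i)) m with hy
  have hrot : ∀ i, A (i + q) ∘ finRotate (n + 1) = fun j => A i j + p := by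
    intro i
    funext j
    rcases Nat.lt_succ_iff_lt_or_eq.1 j.2 with hj | hj
    · have : finRotate (n + 1) j = ⟨j + 1, Nat.succ_lt_succ hj⟩ := finRotate_of_lt hj
      rw [Function.comp_apply, this]
      simp only [hA, shiftSeq]
      push_cast
      rw [show i + q - ((j : ℕ) + 1 - s) * q = i - ((j : ℕ) - s) * q by ring]
      ring
    · have : finRotate (n + 1) j = 0 := by
        have hj' : j = Fin.last n := Fin.ext hj
        rw [hj', finRotate_last]
      rw [Function.comp_apply, this]
      simp only [hA, shiftSeq, hj, Fin.val_zero]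
      have := hζ (i - (n - s) * q)
      rw [show i - (n - s) * q + ((n : ℤ) + 1) * q = i + q - (((0 : ℕ) : ℤ) - s) * q by
        push_cast; ring] at this
      rw [this]
      push_cast
      ring
  have hyq : ∀ m, IsQuasiPeriodic q p (y m) := by
    intro m i
    simp only [hy]
    rw [← Tuple.comp_perm_comp_sort_eq_comp_sort (f := A (i + q)) (σ := finRotate (n + 1)), hrot]
    exact sort_comp_add_const _ _ _
  have hsub : ∀ j a a' b b', a ≤ a' → b ≤ b' → f j a b + f j a' b' ≤ f j a b' + f j a' b := by
    intro j a a' b b' ha hb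
    have h1 := (hf j).hasPairBounds.lower a a' b b' ha hb
    have h2 := mul_nonneg hl (mul_nonneg (sub_nonneg.2 ha) (sub_nonneg.2 hb))
    linarith
  have hsort : ∀ i, ∑ m, pairEnergy f i (y m) ≤ ∑ j : Fin (n + 1), pairEnergy f i
      (shiftSeq (((j : ℕ) - s) * q) (((j : ℕ) - s) * p) ζ) := by
    intro i
    simp only [pairEnergy]
    rw [sum_comm, sum_comm (s := univ (α := Fin (n + 1)))]
    exact sum_le_sum fun j _ => sum_sort_le (hsub j) (A i) (A (i + ((j : ℕ) + 1)))
  calc ((n : ℝ) + 1) * E₀ = ∑ m : Fin (n + 1), E₀ := by simp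
    _ ≤ ∑ m, ∑ i ∈ Ico 0 q, pairEnergy f i (y m) := sum_le_sum fun m _ => hE _ (hyq m)
    _ = ∑ i ∈ Ico 0 q, ∑ m, pairEnergy f i (y m) := sum_comm
    _ ≤ ∑ i ∈ Ico 0 q, ∑ j : Fin (n + 1), pairEnergy f i
      (shiftSeq (((j : ℕ) - s) * q) (((j : ℕ) - s) * p) ζ) := sum_le_sum fun i _ => hsort i
    _ = _ := by
      rw [sum_comm]
      refine sum_congr rfl fun j _ => sum_congr rfl fun i _ => ?_
      rw [pairEnergy_shiftSeq hf]
      congr 1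
      ring

theorem sum_blocks (δ : ℤ → ℝ) {q : ℤ} (hq : 0 ≤ q) (n : ℕ) (s : ℤ) :
    ∑ j : Fin (n + 1), ∑ i ∈ Ico 0 q, δ (i + (s - (j : ℕ)) * q) =
      ∑ t ∈ Ico ((s - n) * q) ((s + 1) * q), δ t := by
  have hblock : ∀ a : ℤ, ∑ i ∈ Ico 0 q, δ (i + a) = ∑ t ∈ Ico a (q + a), δ t := fun a => by
    rw [sum_Ico_add', zero_add]
  simp only [hblock]
  induction n with
  | zero =>
    refine (Fin.sum_univ_one _).trans ?_
    congr 2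
    simp
    ring
  | succ n ih =>
    rw [Fin.sum_univ_castSucc]
    simp only [Fin.val_castSucc, Fin.val_last]
    rw [ih, add_comm]
    have e : q + (s - ((n + 1 : ℕ) : ℤ)) * q = (s - n) * q := by push_cast; ring
    rw [e, ← sum_union (Ico_disjoint_Ico_consecutive _ _ _), Ico_union_Ico_eq_Ico]
    · push_cast
      nlinarith
    · have : (0 : ℤ) ≤ n := by positivity
      nlinarith

/-- A minimizer among `(q, p)`-periodic sequences is a global minimizer. -/
theorem isPairMinimizer_of_periodic_min {r : ℕ} {C lam : ℝ} {f : Fin r → ℝ → ℝ → ℝ}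
    (hf : ∀ j, IsPairInteraction C lam (f j)) (hl : 0 ≤ lam) {q p : ℤ} (hq : 1 ≤ q) {z : ℤ → ℝ}
    (hz : IsQuasiPeriodic q p z) (hE : ∀ z', IsQuasiPeriodic q p z' →
      ∑ i ∈ Ico 0 q, pairEnergy f i z ≤ ∑ i ∈ Ico 0 q, pairEnergy f i z') :
    IsPairMinimizer f z := by
  intro i₀ i₁ y h01 hy
  -- The block `[a, b)` of `n + 1` periods is to contain `[i₀, i₁]` with more than `r` sites to
  -- spare on both sides, so the periodic copies of the variation do not interact.
  obtain ⟨s, hs⟩ : ∃ s : ℕ, (s : ℤ) = |i₁| + r := ⟨(|i₁| + r).toNat, by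
    have := abs_nonneg i₁; omega⟩
  obtain ⟨n, hn⟩ : ∃ n : ℕ, (n : ℤ) = s + |i₀| + r + 1 := ⟨(s + |i₀| + r + 1).toNat, by
    have := abs_nonneg i₀; omega⟩
  set a : ℤ := (s - n) * q with ha
  set b : ℤ := (s + 1) * q with hb
  set P : ℤ := (n + 1) * q with hP
  have hPpos : 0 < P := by positivity
  have hab : b = a + P := by rw [ha, hb, hP]; ring
  have ha0 : a + r < i₀ := by
    have h1 : a ≤ s - n := by
      rw [ha]
      have : (s : ℤ) - n ≤ 0 := by rw [hn]; have := abs_nonneg i₀; omega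
      nlinarith
    have := neg_abs_le i₀
    omega
  have hb1 : i₁ + r < b := by
    have h1 : (s : ℤ) + 1 ≤ b := by rw [hb]; nlinarith
    have := le_abs_self i₁
    omega
  set ρ : ℤ → ℤ := fun t => (t - a) % P + a with hρ
  set ζ : ℤ → ℝ := fun t => z t + (y (ρ t) - z (ρ t)) with hζd
  have hζ : IsQuasiPeriodic ((n + 1) * q) ((n + 1) * p) ζ := by
    intro i
    have h1 : ρ (i + (n + 1) * q) = ρ i := by
      simp only [hρ]
      rw [show i + ((n : ℤ) + 1) * q - a = i - a + P by rw [hP]; ring, Int.add_emod_right]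
    have h2 := hz.add_mul (n + 1) i
    simp only [hζd]
    rw [h1, h2]
    push_cast
    ring
  -- The range extends to `b + r` because the energies at sites below `b` see `r` further sites;
  -- there neither the variation nor its next copy has begun.
  have hζy : ∀ t, a ≤ t → t < b + r → ζ t = y t := by
    intro t h1 h2
    by_cases h3 : t < b
    · have : ρ t = t := by
        simp only [hρ]
        rw [Int.emod_eq_of_lt (by omega) (by omega)]
        ring
      simp only [hζd, this]
      ring
    · have hrP : (r : ℤ) ≤ P := by omega
      have : ρ t = t - P := by
        simp only [hρ]
        rw [← Int.sub_emod_right, Int.emod_eq_of_lt (by omega) (by omega)]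
        ring
      simp only [hζd, this]
      rw [hy (t - P) (by simp only [mem_Icc]; omega), hy t (by simp only [mem_Icc]; omega)]
      ring
  have hsum := sum_translates_ge hf hl hE n s hζ
  have hblock : ((n : ℝ) + 1) * ∑ i ∈ Ico 0 q, pairEnergy f i z =
      ∑ j : Fin (n + 1), ∑ i ∈ Ico 0 q, pairEnergy f (i + (s - (j : ℕ)) * q) z := by
    have : ∀ j : Fin (n + 1), ∑ i ∈ Ico 0 q, pairEnergy f (i + (s - (j : ℕ)) * q) z =
        ∑ i ∈ Ico 0 q, pairEnergy f i z := fun j => by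
      refine sum_congr rfl fun i _ => ?_
      have h1 := pairEnergy_shiftSeq hf (((j : ℕ) - s) * q) (((j : ℕ) - s) * p) i z
      rw [hz.shiftSeq_eq] at h1
      rw [h1]
      congr 1
      ring
    simp [this]
  rw [hblock, sum_blocks (fun t => pairEnergy f t z) (by omega), sum_blocks (fun t => pairEnergy f t ζ) (by omega), ← ha,
    ← hb] at hsum
  have hζe : ∑ t ∈ Ico a b, pairEnergy f t ζ = ∑ t ∈ Ico a b, pairEnergy f t y := by
    refine sum_congr rfl fun t ht => pairEnergy_congr fun i h1 h2 => ?_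
    rw [mem_Ico] at ht
    exact hζy i (by omega) (by omega)
  rw [hζe] at hsum
  have hsubset : Icc (i₀ - r) i₁ ⊆ Ico a b := fun t ht => by
    simp only [mem_Icc, mem_Ico] at ht ⊢
    omega
  have hloc : ∑ t ∈ Icc (i₀ - r) i₁, (pairEnergy f t y - pairEnergy f t z) =
      ∑ t ∈ Ico a b, (pairEnergy f t y - pairEnergy f t z) := by
    refine sum_subset hsubset fun t _ ht => ?_
    rw [pairEnergy_congr (x := y) (y := z), sub_self]
    intro i h1 h2
    refine hy i ?_
    simp only [mem_Icc] at ht ⊢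
    omega
  rw [sum_sub_distrib, sum_sub_distrib] at hloc
  unfold energyOn
  linarith

/-! ### Existence of periodic minimizers. -/

theorem IsPairInteraction.continuous {C lam : ℝ} {f : ℝ → ℝ → ℝ}
    (hf : IsPairInteraction C lam f) : Continuous fun p : ℝ × ℝ => f p.1 p.2 :=
  hf.contDiff.continuous

theorem IsPairInteraction.exists_lower_bound {C lam : ℝ} {f : ℝ → ℝ → ℝ}
    (hf : IsPairInteraction C lam f) : ∃ b, 0 ≤ b ∧ ∀ ν μ, -b ≤ f ν μ := by
  obtain ⟨R, hR⟩ := hf.coercive 0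
  obtain ⟨m, hm⟩ := ((isCompact_Icc (a := (0 : ℝ)) (b := 1)).prod
    (isCompact_Icc (a := -|R|) (b := 1 + |R|))).bddBelow_image hf.continuous.continuousOn
  refine ⟨|m|, abs_nonneg _, fun ν μ => ?_⟩
  rcases le_or_gt R |ν - μ| with h | h
  · linarith [hR ν μ h, abs_nonneg m]
  · have e := hf.add_int ν μ (-⌊ν⌋)
    rw [← e]
    refine (neg_abs_le m).trans (hm ⟨(ν + (-⌊ν⌋ : ℤ), μ + (-⌊ν⌋ : ℤ)), ⟨?_, ?_⟩, rfl⟩)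
    · push_cast
      exact ⟨by linarith [Int.floor_le ν], by linarith [Int.lt_floor_add_one ν]⟩
    · have h1 := abs_lt.1 (h.trans_le (le_abs_self R))
      push_cast
      exact ⟨by linarith [Int.floor_le ν, h1.2],
        by linarith [Int.lt_floor_add_one ν, h1.1]⟩

theorem exists_lower_bound {r : ℕ} {C lam : ℝ} {f : Fin r → ℝ → ℝ → ℝ}
    (hf : ∀ j, IsPairInteraction C lam (f j)) : ∃ b, 0 ≤ b ∧ ∀ j ν μ, -b ≤ f j ν μ := by
  choose b hb hbf using fun j => (hf j).exists_lower_bound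
  refine ⟨∑ j, b j, sum_nonneg fun j _ => hb j, fun j ν μ => ?_⟩
  have := single_le_sum (fun i _ => hb i) (mem_univ j)
  linarith [hbf j ν μ]

/-- Coercivity of the nearest-neighbour interaction bounds the increments of competitors, an integer
translation brings `z 0` into the unit interval, and what remains is compact in the product
topology. -/
theorem exists_periodic_min {r : ℕ} {C lam : ℝ} {f : Fin r → ℝ → ℝ → ℝ}
    (hf : ∀ j, IsPairInteraction C lam (f j)) (hr : 1 ≤ r) {q : ℤ} (hq : 1 ≤ q) (p : ℤ) :
    ∃ z, IsQuasiPeriodic q p z ∧ ∀ z', IsQuasiPeriodic q p z' →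
      ∑ i ∈ Ico 0 q, pairEnergy f i z ≤ ∑ i ∈ Ico 0 q, pairEnergy f i z' := by
  set E : (ℤ → ℝ) → ℝ := fun z => ∑ i ∈ Ico 0 q, pairEnergy f i z with hE
  set z₀ : ℤ → ℝ := fun i => ((p * (i / q) : ℤ) : ℝ) with hz₀
  have hz₀q : IsQuasiPeriodic q p z₀ := by
    intro i
    simp only [hz₀]
    rw [Int.add_ediv_of_dvd_right dvd_rfl, Int.ediv_self (by omega)]
    push_cast
    ring
  obtain ⟨b, hb, hbf⟩ := exists_lower_bound hf
  have hpe : ∀ i z, -(r * b) ≤ pairEnergy f i z := fun i z => by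
    unfold pairEnergy
    refine le_trans (le_of_eq ?_) (sum_le_sum fun j _ => hbf j _ _)
    simp
  -- One nearest-neighbour term of this size, with all other terms bounded below through `-b`, lifts
  -- the energy above that of the staircase `z₀`.
  obtain ⟨R, hR⟩ := (hf ⟨0, hr⟩).coercive (E z₀ + r * b + q * (r * b) + 1)
  set R' := |R| with hR'
  have hgap : ∀ z, IsQuasiPeriodic q p z → E z ≤ E z₀ → ∀ i, |z i - z (i + 1)| ≤ R' := by
    intro z hz hzE i
    by_contra hlt
    push Not at hlt
    set t := i % q with ht
    have ht0 : 0 ≤ t := Int.emod_nonneg _ (by omega)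
    have htq : t < q := Int.emod_lt_of_pos _ (by omega)
    have hi : i = t + (i / q) * q := by rw [ht, mul_comm]; exact (Int.emod_add_mul_ediv i q).symm
    have h1 : |z t - z (t + 1)| = |z i - z (i + 1)| := by
      have e1 := hz.add_mul (i / q) t
      have e2 := hz.add_mul (i / q) (t + 1)
      rw [← hi] at e1
      rw [show t + 1 + i / q * q = i + 1 by omega] at e2
      rw [e1, e2]
      congr 1
      ring
    have h2 := hR (z t) (z (t + 1)) (by rw [h1]; exact (le_abs_self R).trans hlt.le)
    have h3 : f ⟨0, hr⟩ (z t) (z (t + 1)) - r * b ≤ pairEnergy f t z := by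
      unfold pairEnergy
      rw [← add_sum_erase univ _ (mem_univ (⟨0, hr⟩ : Fin r))]
      have : -(r * b) ≤ ∑ j ∈ univ.erase (⟨0, hr⟩ : Fin r), f j (z t) (z (t + ((j : ℕ) + 1))) := by
        refine le_trans ?_ (sum_le_sum fun j _ => hbf j _ _)
        rw [sum_const, nsmul_eq_mul, mul_neg, neg_le_neg_iff]
        refine mul_le_mul_of_nonneg_right ?_ hb
        have := card_le_card (erase_subset (⟨0, hr⟩ : Fin r) univ)
        rw [card_univ, Fintype.card_fin] at this
        exact_mod_cast this
      simp only [CharP.cast_eq_zero, zero_add]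
      linarith
    have h4 : pairEnergy f t z - q * (r * b) ≤ E z := by
      simp only [hE]
      rw [← add_sum_erase (Ico 0 q) _ (mem_Ico.2 ⟨ht0, htq⟩)]
      have : -(q * (r * b)) ≤ ∑ i ∈ (Ico 0 q).erase t, pairEnergy f i z := by
        refine le_trans ?_ (sum_le_sum fun i _ => hpe i z)
        rw [sum_const, nsmul_eq_mul, mul_neg, neg_le_neg_iff]
        refine mul_le_mul_of_nonneg_right ?_ (by positivity)
        have := card_le_card (erase_subset t (Ico 0 q))
        rw [Int.card_Ico] at this
        have h5 : (((Ico 0 q).erase t).card : ℤ) ≤ q := by omega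
        exact_mod_cast h5
      linarith
    linarith
  have hbox : ∀ z, IsQuasiPeriodic q p z → E z ≤ E z₀ → ∀ i, |z i - z 0| ≤ |(i : ℝ)| * R' := by
    intro z hz hzE i
    have hg := hgap z hz hzE
    induction i using Int.induction_on with
    | zero => simp
    | succ n ih =>
      have h1 := hg n
      rw [abs_sub_comm] at h1
      have h2 := abs_sub_le (z (n + 1)) (z n) (z 0)
      push_cast at ih ⊢
      rw [abs_of_nonneg (by positivity : (0 : ℝ) ≤ n)] at ih
      rw [abs_of_nonneg (by positivity : (0 : ℝ) ≤ n + 1)]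
      linarith
    | pred n ih =>
      have h1 := hg (-n - 1)
      rw [sub_add_cancel] at h1
      have h2 := abs_sub_le (z (-n - 1)) (z (-n)) (z 0)
      push_cast at ih ⊢
      rw [abs_neg (n : ℝ), abs_of_nonneg (by positivity : (0 : ℝ) ≤ n)] at ih
      rw [show (-(n : ℝ) - 1) = -(n + 1) by ring, abs_neg,
        abs_of_nonneg (by positivity : (0 : ℝ) ≤ n + 1)]
      linarith
  set K : Set (ℤ → ℝ) := Set.univ.pi (fun i : ℤ => Set.Icc (-(1 + |(i : ℝ)| * R'))
    (1 + |(i : ℝ)| * R')) ∩ {z | IsQuasiPeriodic q p z} with hK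
  have hKc : IsCompact K := by
    refine (isCompact_univ_pi fun i => isCompact_Icc).inter_right ?_
    have : {z : ℤ → ℝ | IsQuasiPeriodic q p z} = ⋂ i, {z : ℤ → ℝ | z (i + q) = z i + p} := by
      ext z
      simp [IsQuasiPeriodic]
    rw [this]
    exact isClosed_iInter fun i => isClosed_eq (continuous_apply _)
      ((continuous_apply _).add continuous_const)
  have hmemK : ∀ z, IsQuasiPeriodic q p z → E z ≤ E z₀ → |z 0| ≤ 1 → z ∈ K := by
    intro z hz hzE h0
    refine ⟨fun i _ => abs_le.1 ?_, hz⟩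
    have h1 := hbox z hz hzE i
    have h2 := abs_sub_le (z i) (z 0) 0
    simp only [sub_zero] at h2
    linarith
  have hEc : Continuous E := by
    refine continuous_finsetSum _ fun i _ => continuous_finsetSum _ fun j _ => ?_
    have h : Continuous fun z : ℤ → ℝ => (z i, z (i + ((j : ℕ) + 1))) := by fun_prop
    exact (hf j).continuous.comp h
  obtain ⟨z, hzK, hzmin⟩ := hKc.exists_isMinOn ⟨z₀, hmemK z₀ hz₀q le_rfl (by simp [hz₀])⟩
    hEc.continuousOn
  refine ⟨z, hzK.2, fun z' hz' => ?_⟩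
  have hz0 : E z ≤ E z₀ := hzmin (hmemK z₀ hz₀q le_rfl (by simp [hz₀]))
  rcases le_or_gt (E z') (E z₀) with h | h
  · have e : E (shiftSeq 0 (-⌊z' 0⌋) z') = E z' := by
      refine sum_congr rfl fun i _ => ?_
      rw [pairEnergy_shiftSeq hf, sub_zero]
    rw [← show E z' = ∑ i ∈ Ico 0 q, pairEnergy f i z' from rfl, ← e]
    refine hzmin (hmemK _ ?_ (e ▸ h) ?_)
    · intro i
      simp only [shiftSeq, sub_zero]
      rw [hz' i]
      ring
    · simp only [shiftSeq, sub_zero]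
      push_cast
      rw [abs_le]
      constructor <;> linarith [Int.floor_le (z' 0), Int.lt_floor_add_one (z' 0)]
  · exact hz0.trans h.le

/-- Periodic global minimizers of every rational rotation number exist. -/
theorem exists_periodic_isPairMinimizer {r : ℕ} {C lam : ℝ} {f : Fin r → ℝ → ℝ → ℝ}
    (hf : ∀ j, IsPairInteraction C lam (f j)) (hr : 1 ≤ r) (hl : 0 ≤ lam) {q : ℤ} (hq : 1 ≤ q)
    (p : ℤ) : ∃ z, IsQuasiPeriodic q p z ∧ IsPairMinimizer f z := by
  obtain ⟨z, hz, hmin⟩ := exists_periodic_min hf hr hq p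
  exact ⟨z, hz, isPairMinimizer_of_periodic_min hf hl hq hz hmin⟩

/-! ### The Harnack inequality and the exclusion of single crossings. -/

/-- The Harnack constant. -/
noncomputable def harnackConst (r : ℕ) (C lam : ℝ) : ℝ := 1 + 2 * r * C / lam

/-- For ordered minimizers the negative part in `nbrSum_le` vanishes, and all neighbours are
controlled by the central site. -/
theorem IsPairMinimizer.windowSum_le_of_le {r : ℕ} {C lam : ℝ} {f : Fin r → ℝ → ℝ → ℝ}
    (hf : ∀ j, HasPairBounds C lam (f j)) {x y : ℤ → ℝ} (hx : IsPairMinimizer f x)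
    (hy : IsPairMinimizer f y) (hC : 0 ≤ C) (hl : 0 < lam) {s : ℤ}
    (h : ∀ t ∈ Icc (s - r) (s + r), y t ≤ x t) :
    windowSum r (excess x y) s ≤ harnackConst r C lam * (x s - y s) := by
  have hs := h s (by simp)
  have h1 := hx.nbrSum_le hf hy hC s
  have h2 : nbrSum r (excess y x) s = 0 :=
    sum_eq_zero fun t ht => excess_eq_zero (h t (mem_of_mem_erase ht))
  rw [h2, mul_zero, zero_add, abs_of_nonneg (sub_nonneg.2 hs), mul_comm lam, ← le_div_iff₀ hl] at h1
  rw [windowSum_eq, excess, max_eq_left (sub_nonneg.2 hs)]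
  unfold harnackConst
  refine (add_le_add_right h1 _).trans (le_of_eq ?_)
  ring

theorem IsPairMinimizer.harnack {r : ℕ} {C lam : ℝ} {f : Fin r → ℝ → ℝ → ℝ}
    (hf : ∀ j, HasPairBounds C lam (f j)) {x y : ℤ → ℝ} (hx : IsPairMinimizer f x)
    (hy : IsPairMinimizer f y) (hC : 0 ≤ C) (hl : 0 < lam) {s : ℤ}
    (h : (∀ t ∈ Icc (s - r) (s + r), y t ≤ x t) ∨ ∀ t ∈ Icc (s - r) (s + r), x t ≤ y t) {t : ℤ}
    (ht : t ∈ Icc (s - r) (s + r)) :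
    |x t - y t| ≤ harnackConst r C lam * |x s - y s| := by
  wlog h' : ∀ t ∈ Icc (s - r) (s + r), y t ≤ x t generalizing x y
  · have h2 := h.resolve_left h'
    have := this hy hx (Or.inl h2) h2
    simpa only [abs_sub_comm] using this
  have h1 := hx.windowSum_le_of_le hf hy hC hl h'
  have h2 : excess x y t ≤ windowSum r (excess x y) s :=
    single_le_sum (fun t _ => excess_nonneg x y t) ht
  rw [excess, max_eq_left (sub_nonneg.2 (h' t ht))] at h2
  rw [abs_of_nonneg (sub_nonneg.2 (h' t ht)), abs_of_nonneg (sub_nonneg.2 (h' s (by simp)))]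
  exact h2.trans h1

/-- Two minimizers which cross once stay apart near both ends. -/
theorem IsPairMinimizer.exists_gap {r : ℕ} {C lam : ℝ} {f : Fin r → ℝ → ℝ → ℝ}
    (hf : ∀ j, HasPairBounds C lam (f j)) {x y : ℤ → ℝ} (hx : IsPairMinimizer f x)
    (hy : IsPairMinimizer f y) (hr : 1 ≤ r) (hC : 0 < C) (hl : 0 < lam) {p q : ℤ}
    (hp : y p < x p) (hq : x q < y q) (h : CrossesUp x y) :
    ∃ δ > 0, ∃ N : ℤ, (∀ i, N ≤ i → δ ≤ x i - y i) ∧ ∀ i, i ≤ -N → δ ≤ y i - x i := by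
  obtain ⟨⟨N₁, h₁⟩, N₂, h₂⟩ := h
  obtain ⟨w, -, -, hw, hne⟩ := exists_crossesAt hp hq.le
  have hV : 0 < localSize r x y w := by
    rcases hne with h | h
    · exact lt_of_lt_of_le (abs_pos.2 (by linarith)) (abs_le_localSize (t := w) _ _ (by omega)
        (by omega))
    · exact lt_of_lt_of_le (abs_pos.2 (by linarith)) (abs_le_localSize (t := w + 1) _ _ (by omega)
        (by omega))
  obtain ⟨c, hc, hb⟩ := exists_crossing_bound (r := r) hr hC hl
  set e := localSize r x y w * √c with he
  have hsc : 0 < √c := Real.sqrt_pos.2 hc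
  have he0 : 0 < e := by positivity
  have hee : c * localSize r x y w ^ 2 = e ^ 2 := by
    rw [he, mul_pow, Real.sq_sqrt hc.le]; ring
  set B := harnackConst r C lam with hB
  have hB0 : 0 < B := by
    rw [hB, harnackConst]
    positivity
  have hN : ∀ i₀ i₁ : ℤ, i₀ ≤ w - r → w + 1 + r ≤ i₁ →
      e ^ 2 ≤ windowSum r (excess y x) i₀ ^ 2 + windowSum r (excess y x) i₁ ^ 2 := by
    intro i₀ i₁ h0 h1
    have := hb f hf x y hx hy i₀ i₁ {w} ⟨by simp; omega, by simp⟩ (by simpa using hw) (by omega)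
    rwa [sum_singleton, hee] at this
  have hP : ∀ i₀ i₁ : ℤ, i₀ ≤ w - r → w + 1 + r ≤ i₁ →
      e ^ 2 ≤ windowSum r (excess x y) i₀ ^ 2 + windowSum r (excess x y) i₁ ^ 2 := by
    intro i₀ i₁ h0 h1
    have := hb f hf y x hy hx i₀ i₁ {w} ⟨by simp; omega, by simp⟩ (by simpa using hw.symm)
      (by omega)
    rwa [sum_singleton, localSize_comm, hee] at this
  refine ⟨e / B, by positivity, |N₁| + |N₂| + |w| + 1 + r, fun i hi => ?_, fun i hi => ?_⟩
  · have a1 := le_abs_self N₁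
    have a2 := abs_nonneg N₂
    have a3 := le_abs_self w
    have a4 := abs_nonneg N₁
    have a5 := abs_nonneg w
    -- The left window is taken where `x ≤ y`, so it has no positive part, and the whole lower bound
    -- `e ^ 2` falls on the window around `i`; Harnack then transfers it to the site `i`.
    have h3 := hP (min (N₂ - r) (w - r)) i (by omega) (by omega)
    rw [windowSum_eq_zero (w := min (N₂ - r) (w - r)) (fun t ht => excess_eq_zero (h₂ t (by
      rw [mem_Icc] at ht; omega)))] at h3
    have h4 := hx.windowSum_le_of_le hf hy hC.le hl (s := i) (fun t ht => h₁ t (by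
      rw [mem_Icc] at ht; omega))
    have h5 : e ≤ windowSum r (excess x y) i :=
      le_of_sq_le_sq (by linarith) (windowSum_nonneg r (excess_nonneg x y) i)
    rw [div_le_iff₀ hB0]
    linarith
  · have a1 := neg_abs_le N₂
    have a2 := abs_nonneg N₂
    have a3 := neg_abs_le w
    have a4 := abs_nonneg N₁
    have a5 := abs_nonneg w
    have h3 := hN i (max (N₁ + r) (w + 1 + r)) (by omega) (by omega)
    rw [windowSum_eq_zero (w := max (N₁ + r) (w + 1 + r)) (fun t ht => excess_eq_zero (h₁ t (by
      rw [mem_Icc] at ht; omega)))] at h3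
    have h4 := hy.windowSum_le_of_le hf hx hC.le hl (s := i) (fun t ht => h₂ t (by
      rw [mem_Icc] at ht; omega))
    have h5 : e ≤ windowSum r (excess y x) i :=
      le_of_sq_le_sq (by linarith) (windowSum_nonneg r (excess_nonneg y x) i)
    rw [div_le_iff₀ hB0]
    linarith

/-- A sequence which drops by at least `δ` every `k` steps tends to `-∞`. -/
theorem exists_le_of_drop {w : ℤ → ℝ} {k : ℕ} (hk : 1 ≤ k) {δ : ℝ} (hδ : 0 < δ) {N : ℤ}
    (h : ∀ i, N ≤ i → w i ≤ w (i - k) - δ) (M : ℝ) : ∃ N' : ℤ, ∀ i, N' ≤ i → w i ≤ M := by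
  set B : ℝ := ∑ t ∈ Ico (N - k) N, |w t| with hB
  have base : ∀ n : ℕ, w (N - k + n) ≤ B := by
    intro n
    induction n using Nat.strong_induction_on with
    | _ n ih =>
      by_cases hn : n < k
      · refine (le_abs_self _).trans (single_le_sum (f := fun t => |w t|)
          (fun _ _ => abs_nonneg _) (mem_Ico.2 ⟨by omega, by omega⟩))
      · have h1 := ih (n - k) (by omega)
        have h2 := h (N - k + n) (by omega)
        rw [show N - (k : ℤ) + ((n - k : ℕ) : ℤ) = N - k + n - k by omega] at h1
        linarith
  have step : ∀ n : ℕ, ∀ i, N - k + n * k ≤ i → w i ≤ B - n * δ := by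
    intro n
    induction n with
    | zero =>
      intro i hi
      have := base (i - (N - k)).toNat
      rw [show N - (k : ℤ) + ((i - (N - k)).toNat : ℤ) = i by push_cast at hi; omega] at this
      simpa using this
    | succ n ih =>
      intro i hi
      push_cast at hi
      have h0 : (0 : ℤ) ≤ n * k := by positivity
      have e : ((n : ℤ) + 1) * k = n * k + k := by ring
      rw [e] at hi
      have h1 := h i (by omega)
      have h2 := ih (i - k) (by omega)
      push_cast
      linarith
  obtain ⟨n, hn⟩ := exists_nat_gt ((B - M) / δ)
  rw [div_lt_iff₀ hδ] at hn
  exact ⟨_, fun i hi => (step n i hi).trans (by linarith)⟩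

/-- A minimizer cannot lie far below another one near both ends. -/
theorem IsPairMinimizer.not_far_below {r : ℕ} {C lam : ℝ} {f : Fin r → ℝ → ℝ → ℝ}
    (hf : ∀ j, IsPairInteraction C lam (f j)) {x z : ℤ → ℝ} (hx : IsPairMinimizer f x)
    (hz : IsPairMinimizer f z) (hr : 1 ≤ r) (hC : 0 < C) (hl : 0 < lam)
    (hR : ∀ M : ℝ, ∃ N : ℤ, ∀ i, N ≤ i → x i - z i ≤ M)
    (hL : ∀ M : ℝ, ∃ N : ℤ, ∀ i, i ≤ N → x i - z i ≤ M) : False := by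
  -- An integer is needed for `z + m` to be a minimizer again; comparison would put `x` below it
  -- everywhere, which fails at `0`.
  set m : ℤ := ⌊x 0 - z 0⌋ - 1 with hm
  have hm0 : (m : ℝ) < x 0 - z 0 := by
    rw [hm]
    push_cast
    linarith [Int.floor_le (x 0 - z 0)]
  obtain ⟨N₁, h₁⟩ := hR m
  obtain ⟨N₂, h₂⟩ := hL m
  have := hx.le_of_le_ends (fun j => (hf j).hasPairBounds) (hz.translate hf 0 m) hr hC hl
    (i₀ := min N₂ 0 - r) (i₁ := max N₁ 0 + r)
    (fun t ht => by
      have := h₂ t (by rw [mem_Icc] at ht; omega)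
      simp only [shiftSeq, sub_zero]
      linarith)
    (fun t ht => by
      have := h₁ t (by rw [mem_Icc] at ht; omega)
      simp only [shiftSeq, sub_zero]
      linarith) (p := 0) (by rw [mem_Icc]; omega)
  simp only [shiftSeq, sub_zero] at this
  linarith

/-- A minimizer does not cross its translates just once. -/
theorem IsPairMinimizer.not_crossesUp_shiftSeq {r : ℕ} {C lam : ℝ} {f : Fin r → ℝ → ℝ → ℝ}
    (hf : ∀ j, IsPairInteraction C lam (f j)) {x : ℤ → ℝ} (hx : IsPairMinimizer f x)
    (hr : 1 ≤ r) (hC : 0 < C) (hl : 0 < lam) {k : ℕ} (hk : 1 ≤ k) (l : ℤ) {p q : ℤ}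
    (hp : x p < shiftSeq k l x p) (hq : shiftSeq k l x q < x q) :
    ¬ CrossesUp (shiftSeq k l x) x ∧
      ¬ CrossesUp x (shiftSeq k l x) := by
  have hT := hx.translate hf k l
  have hfb := fun j => (hf j).hasPairBounds
  -- As `z` is invariant under the translation, the gap between `x` and its translate becomes a
  -- fixed change of `x - z` every `k` steps. Opposite signs of the gap at the two ends send `x - z`
  -- to the same infinity.
  obtain ⟨z, hzq, hz⟩ := exists_periodic_isPairMinimizer hf hr hl.le (q := k) (by omega) l
  have hzs : ∀ i, z (i - k) = z i - l := fun i => by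
    have := hzq (i - k)
    rw [sub_add_cancel] at this
    linarith
  constructor
  · intro h
    obtain ⟨δ, hδ, N, h1, h2⟩ := hT.exists_gap hfb hx hr hC hl hp hq h
    simp only [shiftSeq] at h1 h2
    refine hx.not_far_below hf hz hr hC hl (exists_le_of_drop hk hδ (N := N) fun i hi => ?_)
      fun M => ?_
    · have := h1 i hi
      have := hzs i
      linarith
    · obtain ⟨N', hN'⟩ := exists_le_of_drop (w := fun i => x (-i) - z (-i)) hk hδ (N := N + k)
        (fun i hi => by
          have h3 := h2 (-i + k) (by omega)
          have h4 := hzs (-i + k)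
          rw [add_sub_cancel_right] at h3 h4
          rw [show -(i - (k : ℤ)) = -i + k by ring]
          linarith) M
      refine ⟨-N', fun i hi => ?_⟩
      have := hN' (-i) (by omega)
      rwa [neg_neg] at this
  · intro h
    obtain ⟨δ, hδ, N, h1, h2⟩ := hx.exists_gap hfb hT hr hC hl hq hp h
    simp only [shiftSeq] at h1 h2
    refine hz.not_far_below hf hx hr hC hl (exists_le_of_drop hk hδ (N := N) fun i hi => ?_)
      fun M => ?_
    · have := h1 i hi
      have := hzs i
      linarith
    · obtain ⟨N', hN'⟩ := exists_le_of_drop (w := fun i => z (-i) - x (-i)) hk hδ (N := N + k)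
        (fun i hi => by
          have h3 := h2 (-i + k) (by omega)
          have h4 := hzs (-i + k)
          rw [add_sub_cancel_right] at h3 h4
          rw [show -(i - (k : ℤ)) = -i + k by ring]
          linarith) M
      refine ⟨-N', fun i hi => ?_⟩
      have := hN' (-i) (by omega)
      rwa [neg_neg] at this

/-! ### Translates of sequences that are monotone near the ends. -/

theorem sum_Ico_sub (x : ℤ → ℝ) (a : ℤ) (k : ℕ) :
    ∑ t ∈ Ico (a - k) a, (x (t + 1) - x t) = x a - x (a - k) := by
  induction k with
  | zero => simp
  | succ k ih =>
    have : Ico (a - ((k + 1 : ℕ) : ℤ)) a = insert (a - (k + 1 : ℕ)) (Ico (a - k) a) := by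
      ext t; simp only [mem_insert, mem_Ico]; push_cast; omega
    rw [this, sum_insert (by simp only [mem_Ico]; push_cast; omega), ih]
    rw [show a - ((k + 1 : ℕ) : ℤ) + 1 = a - k by push_cast; ring]
    ring

/-- Where `x` is monotone, a translate of `x` which is on the right side of `x` at some site is
close to `x` at the neighbouring sites. -/
theorem IsPairMinimizer.abs_shiftSeq_sub_le {r : ℕ} {C lam : ℝ} {f : Fin r → ℝ → ℝ → ℝ}
    (hf : ∀ j, IsPairInteraction C lam (f j)) {x : ℤ → ℝ} (hx : IsPairMinimizer f x)
    (hC : 0 ≤ C) (hl : 0 < lam) (k : ℕ) (l : ℤ) {a b : ℤ} (hab : |b - a| ≤ (r : ℤ))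
    (h : ((∀ t ∈ Icc (a - k - r) (a + r), x t ≤ x (t + 1)) ∧ x a ≤ shiftSeq k l x a) ∨
      ((∀ t ∈ Icc (a - k - r) (a + r), x (t + 1) ≤ x t) ∧ shiftSeq k l x a ≤ x a)) :
    |shiftSeq k l x b - x b| ≤ |(l : ℝ)| + k * (harnackConst r C lam * |(l : ℝ)|) := by
  have hS : IsPairMinimizer f (shiftSeq (-1) 0 x) := hx.translate hf (-1) 0
  have hSx : ∀ t, shiftSeq (-1) 0 x t = x (t + 1) := fun t => by
    simp [shiftSeq]
  -- The order at `a` bounds the total change of `x` over `[a - k, a]` by `|l|`; monotonicity turns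
  -- this into a bound on each increment.
  have hsum : ∑ t ∈ Ico (a - k) a, |x (t + 1) - x t| ≤ |(l : ℝ)| := by
    have hsa := sum_Ico_sub x a k
    rcases h with ⟨h1, h2⟩ | ⟨h1, h2⟩
    · have : ∑ t ∈ Ico (a - k) a, |x (t + 1) - x t| = ∑ t ∈ Ico (a - k) a, (x (t + 1) - x t) :=
        sum_congr rfl fun t ht => abs_of_nonneg (sub_nonneg.2 (h1 t (by
          simp only [mem_Ico, mem_Icc] at ht ⊢; omega)))
      rw [this, hsa]
      simp only [shiftSeq] at h2
      linarith [le_abs_self (l : ℝ)]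
    · have : ∑ t ∈ Ico (a - k) a, |x (t + 1) - x t| = -∑ t ∈ Ico (a - k) a, (x (t + 1) - x t) := by
        rw [← sum_neg_distrib]
        exact sum_congr rfl fun t ht => abs_of_nonpos (sub_nonpos.2 (h1 t (by
          simp only [mem_Ico, mem_Icc] at ht ⊢; omega)))
      rw [this, hsa]
      simp only [shiftSeq] at h2
      linarith [neg_abs_le (l : ℝ)]
  rw [abs_le] at hab
  have hterm : ∀ t ∈ Ico (b - k) b,
      |x (t + 1) - x t| ≤ harnackConst r C lam * |(l : ℝ)| := by
    intro t ht
    rw [mem_Ico] at ht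
    have hs : |x (t + a - b + 1) - x (t + a - b)| ≤ |(l : ℝ)| :=
      (single_le_sum (f := fun t => |x (t + 1) - x t|) (fun _ _ => abs_nonneg _)
        (mem_Ico.2 ⟨by omega, by omega⟩)).trans hsum
    -- Increments are differences of the minimizers `x (· + 1)` and `x`, which are ordered here, so
    -- Harnack carries the bound from the interval ending at `a` to the one ending at `b`.
    have h3 := hS.harnack (fun j => (hf j).hasPairBounds) hx hC hl (s := t + a - b) (t := t)
      (by
        simp only [hSx]
        refine h.imp (fun h1 t' ht' => h1.1 t' ?_) fun h1 t' ht' => h1.1 t' ?_ <;>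
        · simp only [mem_Icc] at ht' ⊢
          omega) (by simp only [mem_Icc]; omega)
    rw [hSx, hSx] at h3
    refine h3.trans (mul_le_mul_of_nonneg_left hs ?_)
    unfold harnackConst
    positivity
  have hb : |x b - x (b - k)| ≤ k * (harnackConst r C lam * |(l : ℝ)|) := by
    rw [← sum_Ico_sub]
    refine (abs_sum_le_sum_abs _ _).trans ((sum_le_sum hterm).trans (le_of_eq ?_))
    simp
  have e : shiftSeq k l x b - x b = l + -(x b - x (b - k)) := by
    simp only [shiftSeq]; ring
  rw [e]
  refine (abs_add_le _ _).trans ?_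
  rw [abs_neg]
  linarith

/-- `x` is eventually monotone at both ends. -/
def MonotoneAtEnds (x : ℤ → ℝ) : Prop :=
  ((∃ N : ℤ, ∀ i, N ≤ i → x i ≤ x (i + 1)) ∨ ∃ N : ℤ, ∀ i, N ≤ i → x (i + 1) ≤ x i) ∧
  ((∃ N : ℤ, ∀ i, i ≤ N → x i ≤ x (i + 1)) ∨ ∃ N : ℤ, ∀ i, i ≤ N → x (i + 1) ≤ x i)

theorem add_natCast_le_of_strictMono {k : ℕ → ℤ} (hk : StrictMono k) (n : ℕ) : k 0 + n ≤ k n := by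
  induction n with
  | zero => simp
  | succ n ih =>
    have := hk (Nat.lt_add_one n)
    push_cast
    omega

/-- Far out, all growth sites lie where `x` is monotone, and there the difference is bounded at both
sites of each pair, so the product cannot exceed `2 ^ n` for large `n`. -/
theorem IsPairMinimizer.not_hasGrowth_shiftSeq {r : ℕ} {C lam : ℝ} {f : Fin r → ℝ → ℝ → ℝ}
    (hf : ∀ j, IsPairInteraction C lam (f j)) {x : ℤ → ℝ} (hx : IsPairMinimizer f x)
    (hC : 0 ≤ C) (hl : 0 < lam) (hmono : MonotoneAtEnds x) (k d : ℕ) (l : ℤ) :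
    ¬ HasGrowth r d (fun i => shiftSeq k l x i - x i) := by
  rintro ⟨a, b, hab, -, hnear, hgrow⟩
  set A : ℝ := |(l : ℝ)| + k * (harnackConst r C lam * |(l : ℝ)|) with hA
  have hA0 : 0 ≤ A := by
    rw [hA]
    unfold harnackConst
    positivity
  have hfar : ∃ n₀ : ℕ, ∀ n, n₀ ≤ n →
      (∀ t, (|t - a n| ≤ k + 2 * r) → x t ≤ x (t + 1)) ∨
      (∀ t, (|t - a n| ≤ k + 2 * r) → x (t + 1) ≤ x t) := by
    have hright : StrictMono a → ∀ N : ℤ, ∃ n₀ : ℕ, ∀ n, n₀ ≤ n → ∀ t, |t - a n| ≤ k + 2 * r →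
        N ≤ t := by
      intro ha N
      refine ⟨(N - a 0 + k + 2 * r).toNat, fun n hn t ht => ?_⟩
      have := add_natCast_le_of_strictMono ha n
      rw [abs_le] at ht
      omega
    have hleft : StrictAnti a → ∀ N : ℤ, ∃ n₀ : ℕ, ∀ n, n₀ ≤ n → ∀ t, |t - a n| ≤ k + 2 * r →
        t ≤ N := by
      intro ha N
      refine ⟨(a 0 - N + k + 2 * r).toNat, fun n hn t ht => ?_⟩
      have := add_natCast_le_of_strictMono (k := fun n => -a n) (fun _ _ h => neg_lt_neg (ha h)) n
      rw [abs_le] at ht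
      omega
    rcases hab with ⟨ha, -⟩ | ⟨ha, -⟩
    · rcases hmono.1 with ⟨N, hN⟩ | ⟨N, hN⟩ <;> obtain ⟨n₀, h⟩ := hright ha N
      · exact ⟨n₀, fun n hn => Or.inl fun t ht => hN t (h n hn t ht)⟩
      · exact ⟨n₀, fun n hn => Or.inr fun t ht => hN t (h n hn t ht)⟩
    · rcases hmono.2 with ⟨N, hN⟩ | ⟨N, hN⟩ <;> obtain ⟨n₀, h⟩ := hleft ha N
      · exact ⟨n₀, fun n hn => Or.inl fun t ht => hN t (h n hn t ht)⟩
      · exact ⟨n₀, fun n hn => Or.inr fun t ht => hN t (h n hn t ht)⟩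
  obtain ⟨n₀, hn₀⟩ := hfar
  obtain ⟨n₁, hn₁⟩ := pow_unbounded_of_one_lt ((A + 1) * (A + 1)) (one_lt_two (α := ℝ))
  set n := max n₀ n₁
  obtain ⟨h1, h2, h3⟩ := hgrow n
  have hn := hnear n
  -- If `x` increases the base site is `a n`, where the translate is above `x`; if it decreases the
  -- base site is `b n`, where the translate is below.
  have hbound : ∀ c, c = a n ∨ c = b n → |shiftSeq k l x c - x c| ≤ A := by
    intro c hc
    rw [abs_le] at hn
    rcases hn₀ n (le_max_left _ _) with h | h
    · refine hx.abs_shiftSeq_sub_le hf hC hl k l (a := a n) ?_ (Or.inl ⟨fun t ht => h t ?_, ?_⟩)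
      · rw [abs_le]; omega
      · rw [mem_Icc] at ht; rw [abs_le]; omega
      · linarith
    · refine hx.abs_shiftSeq_sub_le hf hC hl k l (a := b n) ?_ (Or.inr ⟨fun t ht => h t ?_, ?_⟩)
      · rw [abs_le]; omega
      · rw [mem_Icc] at ht; rw [abs_le]; omega
      · linarith
  have h4 := (abs_le.1 (hbound (a n) (Or.inl rfl))).2
  have h5 := (abs_le.1 (hbound (b n) (Or.inr rfl))).1
  have h6 : (2 : ℝ) ^ n₁ ≤ 2 ^ n := pow_le_pow_right₀ (by norm_num) (le_max_right _ _)
  have h7 : (shiftSeq k l x (a n) - x (a n) + 1) *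
      (-(shiftSeq k l x (b n) - x (b n)) + 1) ≤ (A + 1) * (A + 1) :=
    mul_le_mul (by linarith) (by linarith) (by linarith) (by linarith)
  linarith

theorem monotoneAtEnds_of_crossesUp {x y : ℤ → ℝ} (hy : ∀ t, y t = x (t + 1))
    (h : CrossesUp y x ∨ CrossesUp x y) : MonotoneAtEnds x := by
  unfold CrossesUp at h
  simp only [hy] at h
  rcases h with ⟨h1, h2⟩ | ⟨h1, h2⟩
  · exact ⟨Or.inl h1, Or.inr h2⟩
  · exact ⟨Or.inr h1, Or.inl h2⟩

/-! ### The dichotomy for a single minimizer. -/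

/-- A minimizer is Birkhoff unless it oscillates with exponentially growing amplitude. -/
theorem exists_isBirkhoff_or_hasGrowth {r : ℕ} {C lam : ℝ} (hr : 1 ≤ r) (hC : 0 < C)
    (hl : 0 < lam) : ∃ d : ℕ, ∀ f : Fin r → ℝ → ℝ → ℝ, (∀ j, IsPairInteraction C lam (f j)) →
      ∀ x, IsPairMinimizer f x →
      IsBirkhoff x ∨ HasGrowth r d (fun i => x (i + 1) - x i) := by
  obtain ⟨d, hd⟩ := exists_growth_or_crossesUp (r := r) hr hC hl
  refine ⟨d, fun f hf x hx => ?_⟩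
  have hfb := fun j => (hf j).hasPairBounds
  by_contra hcon
  push Not at hcon
  obtain ⟨hB, hG⟩ := hcon
  refine hB ?_
  have hSx : ∀ t, shiftSeq (-1) 0 x t = x (t + 1) := fun t => by simp [shiftSeq]
  -- With growth excluded, `x` and its translate by one site are ordered or cross once; either way
  -- the increments have a constant sign near each end.
  have hmono : MonotoneAtEnds x := by
    by_cases h1 : ∃ p, x p < shiftSeq (-1) 0 x p
    · by_cases h2 : ∃ q, shiftSeq (-1) 0 x q < x q
      · obtain ⟨p, hp⟩ := h1
        obtain ⟨q, hq⟩ := h2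
        rcases hd f hfb _ x (hx.translate hf (-1) 0) hx p q hp hq with h | h
        · simp only [hSx] at h
          exact absurd h hG
        · exact monotoneAtEnds_of_crossesUp hSx h
      · push Not at h2
        simp only [hSx] at h2
        exact ⟨Or.inl ⟨0, fun i _ => h2 i⟩, Or.inl ⟨0, fun i _ => h2 i⟩⟩
    · push Not at h1
      simp only [hSx] at h1
      exact ⟨Or.inr ⟨0, fun i _ => h1 i⟩, Or.inr ⟨0, fun i _ => h1 i⟩⟩
  have hpos : ∀ (k : ℕ) (l : ℤ), 1 ≤ k → shiftSeq k l x ≤ x ∨ x ≤ shiftSeq k l x := by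
    intro k l hk
    by_contra h
    push Not at h
    obtain ⟨h1, h2⟩ := h
    simp only [Pi.le_def, not_forall, not_le] at h1 h2
    obtain ⟨p, hp⟩ := h1
    obtain ⟨q, hq⟩ := h2
    have hno := hx.not_crossesUp_shiftSeq hf hr hC hl hk l hp hq
    rcases hd f hfb _ x (hx.translate hf k l) hx p q hp hq with h | h | h
    · exact hx.not_hasGrowth_shiftSeq hf hC.le hl hmono k d l h
    · exact hno.1 h
    · exact hno.2 h
  intro k l
  rcases lt_trichotomy k 0 with hk | rfl | hk
  -- The translation by `(-n, l)` is the inverse of the one by `(n, -l)`, so the order relation is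
  -- reversed.
  · obtain ⟨n, rfl⟩ : ∃ n : ℕ, k = -n := ⟨(-k).toNat, by omega⟩
    rcases hpos n (-l) (by omega) with h | h
    · right
      intro i
      have := h (i - -n)
      simp only [shiftSeq] at this ⊢
      push_cast at this
      rw [sub_neg_eq_add, add_sub_cancel_right] at this
      rw [sub_neg_eq_add]
      linarith
    · left
      intro i
      have := h (i - -n)
      simp only [shiftSeq] at this ⊢
      push_cast at this
      rw [sub_neg_eq_add, add_sub_cancel_right] at this
      rw [sub_neg_eq_add]
      linarith
  · rcases le_total l 0 with h | h
    · left
      intro i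
      have : (l : ℝ) ≤ 0 := by exact_mod_cast h
      simpa [shiftSeq] using this
    · right
      intro i
      have : (0 : ℝ) ≤ l := by exact_mod_cast h
      simpa [shiftSeq] using this
  · obtain ⟨n, rfl⟩ : ∃ n : ℕ, k = n := ⟨k.toNat, by omega⟩
    exact hpos n l (by omega)

/-! ### Back to the local energy and the final estimate. -/

theorem segmentEnergy_eq_energyOn {r : ℕ} {f : Fin r → ℝ → ℝ → ℝ} {S : (Fin (r + 1) → ℝ) → ℝ}
    (hS : ∀ ξ, S ξ = ∑ j : Fin r, f j (ξ 0) (ξ j.succ)) (i₀ i₁ : ℤ) (x : ℤ → ℝ) :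
    segmentEnergy S i₀ i₁ x = energyOn f (i₀ - r) i₁ x := by
  refine sum_congr rfl fun i _ => ?_
  rw [localEnergyAt, hS]
  refine sum_congr rfl fun j _ => ?_
  simp

theorem IsGlobalMinimizer.isPairMinimizer {r : ℕ} {f : Fin r → ℝ → ℝ → ℝ}
    {S : (Fin (r + 1) → ℝ) → ℝ} (hS : ∀ ξ, S ξ = ∑ j : Fin r, f j (ξ 0) (ξ j.succ)) {x : ℤ → ℝ}
    (hx : IsGlobalMinimizer S x) : IsPairMinimizer f x := by
  intro i₀ i₁ y h01 hy
  have := hx i₀ i₁ h01 (y - x) (fun i hi => by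
    by_contra h
    refine hi ?_
    rw [Pi.sub_apply, hy i (by simpa using h), sub_self])
  rwa [segmentEnergy_eq_energyOn hS, segmentEnergy_eq_energyOn hS, add_sub_cancel] at this

theorem le_or_le_of_two_pow_le_mul {a b : ℝ} (ha : 0 ≤ a) (hb : 0 ≤ b) {n : ℕ}
    (h : (2 : ℝ) ^ n ≤ (a + 1) * (b + 1)) :
    (2 : ℝ) ^ ((n : ℝ) / 2) - 1 ≤ a ∨ (2 : ℝ) ^ ((n : ℝ) / 2) - 1 ≤ b := by
  by_contra hcon
  push Not at hcon
  have h1 : (2 : ℝ) ^ ((n : ℝ) / 2) * (2 : ℝ) ^ ((n : ℝ) / 2) = 2 ^ n := by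
    rw [← Real.rpow_add (by norm_num), add_halves, Real.rpow_natCast]
  have h2 : (a + 1) * (b + 1) < (2 : ℝ) ^ ((n : ℝ) / 2) * (2 : ℝ) ^ ((n : ℝ) / 2) :=
    mul_lt_mul'' (by linarith [hcon.1]) (by linarith [hcon.2]) (by linarith) (by linarith)
  linarith

end NewtonianCrystal

theorem theoremD (r : ℕ) (hr : 1 ≤ r) (K lam : ℝ) (hK : 0 < K) (hlam : 0 < lam) :
    ∃ d : ℕ, ∀ S : (Fin (r + 1) → ℝ) → ℝ, NewtonianCrystal.IsLocalEnergy r K lam S →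
      ∀ x : ℤ → ℝ, NewtonianCrystal.IsGlobalMinimizer S x →
        NewtonianCrystal.IsBirkhoff x ∨
        (¬ NewtonianCrystal.IsBirkhoff x ∧
          ∃ k l : ℕ → ℤ,
            ((StrictMono k ∧ StrictMono l) ∨ (StrictAnti k ∧ StrictAnti l)) ∧
            (∀ n : ℕ, |k (n + 1) - k n| ≤ (d : ℤ)) ∧
            (∀ n : ℕ, |l n - k n| ≤ (r : ℤ)) ∧
            ((∀ n : ℕ, (2 : ℝ) ^ n ≤
                (x (k n + 1) - x (k n) + 1) * (x (l n) - x (l n + 1) + 1)) ∨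
              (∀ n : ℕ, (2 : ℝ) ^ n ≤
                (x (k n + 1) - x (k n) - 1) * (x (l n) - x (l n + 1) - 1))) ∧
            (∀ n : ℕ, (2 : ℝ) ^ ((n : ℝ) / 2) - 1 ≤ x (k n + 1) - x (k n) ∨
              (2 : ℝ) ^ ((n : ℝ) / 2) - 1 ≤ x (l n) - x (l n + 1))) := by
  have hr0 : (0 : ℝ) < r := by exact_mod_cast hr
  obtain ⟨d, hd⟩ := NewtonianCrystal.exists_isBirkhoff_or_hasGrowth (r := r) (C := K / r) hr
    (div_pos hK hr0) hlam
  refine ⟨d, fun S hS x hx => ?_⟩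
  obtain ⟨f, hSf, hf⟩ := hS
  by_cases hB : NewtonianCrystal.IsBirkhoff x
  · exact Or.inl hB
  refine Or.inr ⟨hB, ?_⟩
  obtain ⟨k, l, h1, h2, h3, h4⟩ :=
    (hd f hf x (NewtonianCrystal.IsGlobalMinimizer.isPairMinimizer hSf hx)).resolve_left hB
  have h5 : ∀ n : ℕ, (2 : ℝ) ^ n ≤
      (x (k n + 1) - x (k n) + 1) * (x (l n) - x (l n + 1) + 1) := fun n => by
    have := (h4 n).2.2
    rwa [neg_sub] at this
  -- The alternative with `+ 1` can always be chosen; as both of its factors are at least `1`, one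
  -- of them reaches the square root of `2 ^ n`.
  refine ⟨k, l, h1, h2, h3, Or.inl h5, fun n => ?_⟩
  exact NewtonianCrystal.le_or_le_of_two_pow_le_mul (h4 n).1 (by linarith [(h4 n).2.1]) (h5 n)
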